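/- Let $h\colon\mathbb Z^2\to\mathbb Z$ be a height function: $|h(i,j)-h(i',j')|=1$ whenever $|i-i'|+|j-j'|=1$, $h(i,j)\equiv i+j \pmod 2$, and $h(i,j)+|i|+|j|\to\infty$ as $|i|+|j|\to\infty$. Take independent variables $x(i,j)$ (face variables) for $(i,j)\in\mathbb Z^2$ and $a(i,j),b(i,j),c(i,j),d(i,j)$ (edge variables) for $(i,j)\in\mathbb Z^2$ with $i+j$ odd; let $K$ be the field of rational functions in them and $R=\mathbb Z[x(i,j)^{\pm1},a(i,j),b(i,j),c(i,j),d(i,j)]\subset K$. For $(n,i,j)\in\mathbb Z^3$ with $n\equiv i+j\pmod 2$ and $n\ge h(i,j)$ define $f(n,i,j)\in K$ recursively by $f(n,i,j)=x(i,j)$ if $n=h(i,j)$, and, if $n>h(i,j)$, by the relation $$f(n,i,j)f(n-2,i,j)=a(i+n-1,j)\,c(i-n+1,j)\,f(n-1,i,j+1)f(n-1,i,j-1)+b(i,j+n-1)\,d(i,j-n+1)\,f(n-1,i+1,j)f(n-1,i-1,j).$$ Proposition. For every $(n,i,j)$ with $n\equiv i+j \pmod 2$ and $n>h(i,j)$,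 this relation holds in $K$, and the two terms on its right-hand side lie in $R$. Each monomial of $R$ that appears on the right-hand side (that is, in the expansion of at least one of the two terms) appears in exactly one of the two terms, and it appears with coefficient $2^k$ for some integer $k\ge 0$ (depending on the monomial). The same is true of the two terms after all face variables $x(i,j)$ have been set equal to $1$. -/

import Mathlib

namespace Octahedron

/-- A point `(n, i, j)` of the lattice `ℒ = {(n, i, j) ∈ ℤ³ : n ≡ i + j mod 2}`. -/
@[ext]
structure LatticePoint where
  n : ℤ
  i : ℤ
  j : ℤ
  parity : Even (n + i + j)

/-- The four symbols `a`, `b`, `c`, `d`. -/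
inductive EdgeSymbol
  | a
  | b
  | c
  | d

/-- The index set of the edge variables: triples `(i, j, q)` with `i + j` odd and
`q ∈ {a, b, c, d}`. -/
@[ext]
structure EdgeIndex where
  i : ℤ
  j : ℤ
  q : EdgeSymbol
  parity : Odd (i + j)

/-- The index set of the face variables. -/
abbrev FaceIndex : Type := ℤ × ℤ

namespace LatticePoint

variable (p : LatticePoint)

/-- `(n - 2, i, j)` -/
def below : LatticePoint := ⟨p.n - 2, p.i, p.j, by have := p.parity; grind⟩

/-- `(n - 1, i, j + 1)` -/
def north : LatticePoint := ⟨p.n - 1, p.i, p.j + 1, by have := p.parity; grind⟩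

/-- `(n - 1, i, j - 1)` -/
def south : LatticePoint := ⟨p.n - 1, p.i, p.j - 1, by have := p.parity; grind⟩

/-- `(n - 1, i + 1, j)` -/
def east : LatticePoint := ⟨p.n - 1, p.i + 1, p.j, by have := p.parity; grind⟩

/-- `(n - 1, i - 1, j)` -/
def west : LatticePoint := ⟨p.n - 1, p.i - 1, p.j, by have := p.parity; grind⟩

/-- The index of the variable `a(i + n - 1, j)`. -/
def edgeA : EdgeIndex := ⟨p.i + p.n - 1, p.j, .a, by have := p.parity; grind⟩

/-- The index of the variable `b(i, j + n - 1)`. -/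
def edgeB : EdgeIndex := ⟨p.i, p.j + p.n - 1, .b, by have := p.parity; grind⟩

/-- The index of the variable `c(i - n + 1, j)`. -/
def edgeC : EdgeIndex := ⟨p.i - p.n + 1, p.j, .c, by have := p.parity; grind⟩

/-- The index of the variable `d(i, j - n + 1)`. -/
def edgeD : EdgeIndex := ⟨p.i, p.j - p.n + 1, .d, by have := p.parity; grind⟩

end LatticePoint

/-- A height function `h : ℤ² → ℤ`. -/
structure HeightFunction where
  toFun : ℤ → ℤ → ℤ
  adjacent : ∀ i₁ j₁ i₂ j₂ : ℤ, |i₁ - i₂| + |j₁ - j₂| = 1 →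
    |toFun i₁ j₁ - toFun i₂ j₂| = 1
  parity : ∀ i j : ℤ, Even (toFun i j + i + j)
  tendsto : Filter.Tendsto (fun v : ℤ × ℤ => toFun v.1 v.2 + |v.1| + |v.2|)
    (Filter.comap (fun v : ℤ × ℤ => |v.1| + |v.2|) Filter.atTop) Filter.atTop

instance : CoeFun HeightFunction (fun _ => ℤ → ℤ → ℤ) := ⟨HeightFunction.toFun⟩

/-- Exponents of the monomials of `R`: an integer for each face variable and a natural number
for each edge variable. -/
abbrev Exponent : Type := (FaceIndex →₀ ℤ) × (EdgeIndex →₀ ℕ)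

/-- The ring `R = ℤ[x(i,j), 1/x(i,j), a(i,j), b(i,j), c(i,j), d(i,j)]`, in which
`P.coeff m` is the coefficient of the monomial with exponent `m` in `P`. -/
abbrev R : Type := AddMonoidAlgebra ℤ Exponent

/-- The field `K` of rational functions in the face and edge variables, as the fraction field
of `R`; the embedding `R ⊆ K` is `algebraMap R K`. -/
abbrev K : Type := FractionRing R

/-- The face variable `x(i, j)`, as an element of `R`. -/
noncomputable def faceR (v : FaceIndex) : R :=
  AddMonoidAlgebra.single (Finsupp.single v 1, 0) 1

/-- The edge variable with index `e`, as an element of `R`. -/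
noncomputable def edgeR (e : EdgeIndex) : R :=
  AddMonoidAlgebra.single (0, Finsupp.single e 1) 1

/-- The face variable `x(i, j)`, as an element of `K`. -/
noncomputable def x (i j : ℤ) : K := algebraMap R K (faceR (i, j))

/-- The edge variable with index `e`, as an element of `K`. -/
noncomputable def y (e : EdgeIndex) : K := algebraMap R K (edgeR e)

/-- The ring homomorphism `R → ℤ[a(i,j), b(i,j), c(i,j), d(i,j)]` that sets all face variables
equal to `1`. -/
noncomputable def setFacesOne : R →+* AddMonoidAlgebra ℤ (EdgeIndex →₀ ℕ) :=
  AddMonoidAlgebra.mapDomainRingHom ℤ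
    (AddMonoidHom.snd (FaceIndex →₀ ℤ) (EdgeIndex →₀ ℕ))

/-- Each monomial that appears in `P` or in `Q` appears in exactly one of the two, and its
coefficient in the sum `P + Q` is `2 ^ k` for some `k`. -/
def MonomialsSplit {M : Type} (P Q : AddMonoidAlgebra ℤ M) : Prop :=
  ∀ m : M, P.coeff m ≠ 0 ∨ Q.coeff m ≠ 0 →
    Xor (P.coeff m ≠ 0) (Q.coeff m ≠ 0) ∧ ∃ k : ℕ, (P + Q).coeff m = 2 ^ k

namespace HeightFunction

variable (h : HeightFunction)

/-- `C_{(n,i,j)} ∩ 𝒰`: the lattice points of the cone with vertex `p` that lie strictly above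
the initial surface. -/
def coneAbove (p : LatticePoint) : Set LatticePoint :=
  {q | q.n ≤ p.n - |q.i - p.i| - |q.j - p.j| ∧ h q.i q.j < q.n}

theorem coneAbove_finite (p : LatticePoint) : (h.coneAbove p).Finite := by
  have ht := Filter.tendsto_atTop.1 h.tendsto (p.n + |p.i| + |p.j|)
  rw [Filter.eventually_comap] at ht
  obtain ⟨N, hN⟩ := Filter.eventually_atTop.1 ht
  have hb : ∀ q ∈ h.coneAbove p, |q.i| + |q.j| < N := by
    rintro q ⟨h1, h2⟩
    by_contra! hc
    have h3 := hN _ hc (q.i, q.j) rfl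
    have h4 := abs_sub_abs_le_abs_sub q.i p.i
    have h5 := abs_sub_abs_le_abs_sub q.j p.j
    simp only at h3
    linarith
  let e : LatticePoint → (ℤ × ℤ) × ℤ := fun q => ((q.i, q.j), q.n)
  have he : Function.Injective e := by
    intro q r hqr
    simp only [e, Prod.mk.injEq] at hqr
    exact LatticePoint.ext hqr.2 hqr.1.1 hqr.1.2
  refine Set.Finite.of_finite_image (f := e) ?_ he.injOn
  refine Set.Finite.subset (Set.Finite.biUnion
    ((Set.finite_Icc (-N) N).prod (Set.finite_Icc (-N) N))
    (fun v _ => (Set.finite_Icc (h v.1 v.2) p.n).image (fun n => (v, n)))) ?_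
  rintro _ ⟨q, hq, rfl⟩
  have h1 := hb q hq
  have h2 := abs_nonneg q.i
  have h3 := abs_nonneg q.j
  obtain ⟨h4, h5⟩ := hq
  have h6 := abs_nonneg (q.i - p.i)
  have h7 := abs_nonneg (q.j - p.j)
  simp only [Set.mem_iUnion]
  refine ⟨(q.i, q.j), ⟨abs_le.1 (by linarith), abs_le.1 (by linarith)⟩, q.n, ?_, rfl⟩
  exact ⟨h5.le, by linarith⟩

theorem ncard_coneAbove_lt {p q : LatticePoint} (hp : h p.i p.j < p.n) (hlt : q.n < p.n)
    (hq : q.n ≤ p.n - |q.i - p.i| - |q.j - p.j|) :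
    (h.coneAbove q).ncard < (h.coneAbove p).ncard := by
  refine Set.ncard_lt_ncard ⟨?_, fun hs => ?_⟩ (h.coneAbove_finite p)
  · rintro r ⟨h1, h2⟩
    refine ⟨?_, h2⟩
    have h3 := abs_sub_le r.i q.i p.i
    have h4 := abs_sub_le r.j q.j p.j
    linarith
  · have hmem : p ∈ h.coneAbove p := ⟨by simp, hp⟩
    have h1 := (hs hmem).1
    have h2 := abs_nonneg (p.i - q.i)
    have h3 := abs_nonneg (p.j - q.j)
    linarith

open Classical in
/-- The function `f : ℐ ∪ 𝒰 → K` generated by the octahedron recurrence from the initial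
values `f(h(i,j), i, j) = x(i, j)`. (At the lattice points below the initial surface, which are
outside the domain `ℐ ∪ 𝒰` and are never reached by the recurrence, it has the irrelevant value
`x(i, j)`.) -/
noncomputable def f (p : LatticePoint) : K :=
  if _hp : h p.i p.j < p.n then
    (y p.edgeA * y p.edgeC * f p.north * f p.south +
      y p.edgeB * y p.edgeD * f p.east * f p.west) / f p.below
  else x p.i p.j
termination_by (h.coneAbove p).ncard
decreasing_by
  all_goals
    refine h.ncard_coneAbove_lt _hp ?_ ?_ <;>
    simp [LatticePoint.north, LatticePoint.south, LatticePoint.east, LatticePoint.west,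
      LatticePoint.below]

end HeightFunction

end Octahedron

open Octahedron

/-! ### Integral group algebras: gradings, maximal degrees and prime binomials. -/

namespace GroupAlgebra

open AddMonoidAlgebra

variable {Γ : Type*}

/-! All variables are made invertible, so that exponents form a group, and the recurrence is solved
as `g`. The induction is on the number of lattice points above the surface in the downward cone of
the given vertex. A lowest such point `u` sits over a local minimum of `h`; raising that minimum to
`u` (`raise`) removes `u` from the count. Write x for the face variable below `u` and β for
`binomial u`, so that `g u` is β/x. The values for `h` arise from those for the raised surface by
substituting β/x for x (`flipHom_g`).

Degrees control this substitution. The recurrence is subtraction-free, so nothing cancels and any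
solution of the tropical recurrence gives the maximal degrees (`hasFractionDeg_g`). Explicit
tropical solutions show that edge exponents are nonnegative (`edgeDeg_nonneg`) and that every value
is homogeneous, of weight at most 1, for the total degree `weight u` in x and four edge variables
around it (`weight_eq`, `weightAt_le_one`).

Laurentness (`exists_laurent`): by induction and the substitution, a value is X/β^n with X Laurent.
Its product with the value below is Laurent, β is prime, and β does not divide the value below
(`not_binomial_dvd`); hence β^n divides X. If the value below is the one at `u` itself, an explicit
identity replaces this argument.

Coefficients: both terms of the relation have the same weight w ≤ 2. Comparing components of degree
k and -k in x, this bound leaves only one summand of the expansion of β^k for each coefficient, and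
it forces k ≤ 2 whenever a binomial factor appears. So a flip translates exponents and multiplies
surviving coefficients by 1 or 2 (`coeff_flip`, `flipFactor_eq`). Translation and factor depend on
edge exponents alone and are the same for both terms, so the stronger property `StronglySplit`, in
which edge exponents determine the monomial, is preserved. This extra property is what allows the
face variables to be set to 1. -/

/-- The monomial with exponent `m`. -/
noncomputable abbrev mon (m : Γ) : AddMonoidAlgebra ℤ Γ := single m 1

theorem coeff_mon_same (m : Γ) : (mon m).coeff m = 1 := by simp [mon]

theorem coeff_mon_ne {m n : Γ} (h : m ≠ n) : (mon m).coeff n = 0 := by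
  simp [mon, h]

theorem eq_of_coeff_mon_ne_zero {m n : Γ} (h : (mon m).coeff n ≠ 0) : m = n := by
  by_contra hne
  exact h (coeff_mon_ne hne)

theorem mon_ne_zero (m : Γ) : mon m ≠ 0 := by simp [mon]

theorem exists_coeff_ne_zero {P : AddMonoidAlgebra ℤ Γ} (hP : P ≠ 0) : ∃ m, P.coeff m ≠ 0 := by
  by_contra! h
  exact hP (coeff_injective (Finsupp.ext h))

variable [AddCommGroup Γ]

theorem mon_add (m n : Γ) : mon (m + n) = mon m * mon n := by
  simp [mon, single_mul_single]

theorem mon_zero : mon (0 : Γ) = 1 := rfl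

theorem mon_nsmul (k : ℕ) (m : Γ) : mon (k • m) = mon m ^ k := by
  simp [mon, single_pow]

theorem coeff_mon_mul (m n : Γ) (P : AddMonoidAlgebra ℤ Γ) :
    (mon m * P).coeff n = P.coeff (n - m) := by
  rw [mon, coeff_single_mul_apply, one_mul, neg_add_eq_sub]

theorem exists_of_coeff_mul_ne_zero {P Q : AddMonoidAlgebra ℤ Γ} {m : Γ}
    (h : (P * Q).coeff m ≠ 0) : ∃ n, P.coeff n ≠ 0 ∧ Q.coeff (m - n) ≠ 0 := by
  by_contra! hc
  refine h ?_
  rw [coeff_mul_apply_left]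
  refine Finset.sum_eq_zero fun a ha => ?_
  simp only [neg_add_eq_sub, hc a (Finsupp.mem_support_iff.1 ha), mul_zero]

/-- The part of `P` consisting of the monomials of degree `k` under the grading `w`. -/
noncomputable def component (w : Γ →+ ℤ) (k : ℤ) (P : AddMonoidAlgebra ℤ Γ) :
    AddMonoidAlgebra ℤ Γ := ofCoeff (P.coeff.filter (fun m => w m = k))

theorem coeff_component (w : Γ →+ ℤ) (k : ℤ) (P : AddMonoidAlgebra ℤ Γ) (m : Γ) :
    (component w k P).coeff m = if w m = k then P.coeff m else 0 := by
  simp [component, Finsupp.filter_apply]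

theorem component_add (w : Γ →+ ℤ) (k : ℤ) (P Q : AddMonoidAlgebra ℤ Γ) :
    component w k (P + Q) = component w k P + component w k Q := by
  refine coeff_injective (Finsupp.ext fun m => ?_)
  simp only [coeff_component, coeff_add, Finsupp.add_apply]
  split_ifs <;> simp

theorem component_mul_of_homogeneous {w : Γ →+ ℤ} {S : AddMonoidAlgebra ℤ Γ} {e : ℤ}
    (hS : ∀ m, S.coeff m ≠ 0 → w m = e) (k : ℤ) (P : AddMonoidAlgebra ℤ Γ) :
    component w (e + k) (S * P) = S * component w k P := by
  refine coeff_injective (Finsupp.ext fun m => ?_)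
  rw [coeff_component]
  split_ifs with h
  · rw [coeff_mul_apply_left, coeff_mul_apply_left]
    refine Finset.sum_congr rfl fun a ha => ?_
    have := hS a (Finsupp.mem_support_iff.1 ha)
    simp only [coeff_component, map_add, map_neg]
    rw [if_pos (by omega)]
  · symm
    by_contra hc
    obtain ⟨n, h1, h2⟩ := exists_of_coeff_mul_ne_zero hc
    rw [coeff_component] at h2
    have h3 := hS n h1
    split_ifs at h2 with h4
    · rw [map_sub] at h4
      omega
    · exact h2 rfl

/-- `d` is the largest degree of a monomial of `P` under the grading `w`. -/
def HasMaxDeg (w : Γ →+ ℤ) (P : AddMonoidAlgebra ℤ Γ) (d : ℤ) : Prop :=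
  (∀ m, P.coeff m ≠ 0 → w m ≤ d) ∧ ∃ m, P.coeff m ≠ 0 ∧ w m = d

theorem HasMaxDeg.ne_zero {w : Γ →+ ℤ} {P : AddMonoidAlgebra ℤ Γ} {d : ℤ}
    (h : HasMaxDeg w P d) : P ≠ 0 := by
  rintro rfl
  obtain ⟨m, hm, -⟩ := h.2
  simp at hm

theorem HasMaxDeg.unique {w : Γ →+ ℤ} {P : AddMonoidAlgebra ℤ Γ} {d e : ℤ}
    (h : HasMaxDeg w P d) (h' : HasMaxDeg w P e) : d = e := by
  obtain ⟨m, hm, rfl⟩ := h.2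
  obtain ⟨n, hn, rfl⟩ := h'.2
  exact le_antisymm (h'.1 m hm) (h.1 n hn)

theorem exists_hasMaxDeg (w : Γ →+ ℤ) {P : AddMonoidAlgebra ℤ Γ} (hP : P ≠ 0) :
    ∃ d, HasMaxDeg w P d := by
  obtain ⟨m, hm⟩ := exists_coeff_ne_zero hP
  obtain ⟨n, hn, hmax⟩ := P.coeff.support.exists_max_image w ⟨m, Finsupp.mem_support_iff.2 hm⟩
  exact ⟨w n, fun k hk => hmax k (Finsupp.mem_support_iff.2 hk), n,
    Finsupp.mem_support_iff.1 hn, rfl⟩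

theorem hasMaxDeg_mon (w : Γ →+ ℤ) (m : Γ) : HasMaxDeg w (mon m) (w m) :=
  ⟨fun n hn => by rw [eq_of_coeff_mon_ne_zero hn], m, by rw [coeff_mon_same]; simp, rfl⟩

/-- The top component of the product is the product of the top components, nonzero in the absence of
zero divisors. -/
theorem HasMaxDeg.mul [NoZeroDivisors (AddMonoidAlgebra ℤ Γ)] {w : Γ →+ ℤ}
    {P Q : AddMonoidAlgebra ℤ Γ} {d e : ℤ} (hP : HasMaxDeg w P d) (hQ : HasMaxDeg w Q e) :
    HasMaxDeg w (P * Q) (d + e) := by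
  have top_ne {P : AddMonoidAlgebra ℤ Γ} {d : ℤ} (hP : HasMaxDeg w P d) :
      component w d P ≠ 0 := by
    obtain ⟨m, hm, hd⟩ := hP.2
    intro h0
    have := congrArg (fun F => F.coeff m) h0
    simp only [coeff_component, hd, if_true] at this
    exact hm (by simpa using this)
  refine ⟨fun m hm => ?_, ?_⟩
  · obtain ⟨n, h1, h2⟩ := exists_of_coeff_mul_ne_zero hm
    have h3 := hP.1 _ h1
    have h4 := hQ.1 _ h2
    rw [map_sub] at h4
    omega
  · obtain ⟨m, hm⟩ := exists_coeff_ne_zero (mul_ne_zero (top_ne hP) (top_ne hQ))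
    obtain ⟨n, h1, h2⟩ := exists_of_coeff_mul_ne_zero hm
    have hd : w m = d + e := by
      rw [coeff_component] at h1 h2
      have h3 : w n = d := by
        by_contra h
        exact h1 (if_neg h)
      have h4 : w (m - n) = e := by
        by_contra h
        exact h2 (if_neg h)
      rw [map_sub] at h4
      omega
    refine ⟨m, ?_, hd⟩
    convert hm using 1
    have hhom : ∀ n, (component w d P).coeff n ≠ 0 → w n = d := by
      intro n hn
      rw [coeff_component] at hn
      by_contra h
      simp [h] at hn
    rw [← component_mul_of_homogeneous hhom, coeff_component, if_pos hd,
      coeff_mul_apply_left, coeff_mul_apply_left]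
    rw [Finsupp.sum_of_support_subset (s := P.coeff.support) _ subset_rfl _ (by simp),
      Finsupp.sum_of_support_subset (s := P.coeff.support) _ ?_ _ (by simp)]
    · refine Finset.sum_congr rfl fun a ha => ?_
      rw [coeff_component]
      split_ifs with h
      · rfl
      · have h5 := hP.1 a (Finsupp.mem_support_iff.1 ha)
        rw [zero_mul]
        by_contra h6
        have h7 := hQ.1 _ (right_ne_zero_of_mul h6)
        rw [map_add, map_neg] at h7
        omega
    · intro a ha
      rw [Finsupp.mem_support_iff, coeff_component] at ha
      rw [Finsupp.mem_support_iff]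
      intro h
      simp [h] at ha

/-- The elements of the group algebra with nonnegative coefficients. -/
noncomputable def nonnegative (Γ : Type*) [AddCommGroup Γ] : Subsemiring (AddMonoidAlgebra ℤ Γ) :=
  (mapRingHom Γ (Nat.castRingHom ℤ)).rangeS

theorem mon_mem_nonnegative (m : Γ) : mon m ∈ nonnegative Γ :=
  ⟨single m 1, by simp⟩

theorem coeff_nonneg {P : AddMonoidAlgebra ℤ Γ} (hP : P ∈ nonnegative Γ) (m : Γ) :
    0 ≤ P.coeff m := by
  obtain ⟨Q, rfl⟩ := hP
  simp

/-- Nonnegative coefficients cannot cancel. -/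
theorem HasMaxDeg.add {w : Γ →+ ℤ} {P Q : AddMonoidAlgebra ℤ Γ} {d e : ℤ}
    (hP : HasMaxDeg w P d) (hQ : HasMaxDeg w Q e) (hP0 : P ∈ nonnegative Γ)
    (hQ0 : Q ∈ nonnegative Γ) : HasMaxDeg w (P + Q) (max d e) := by
  have key (m : Γ) : (P + Q).coeff m ≠ 0 ↔ P.coeff m ≠ 0 ∨ Q.coeff m ≠ 0 := by
    have h1 := coeff_nonneg hP0 m
    have h2 := coeff_nonneg hQ0 m
    simp only [coeff_add, Finsupp.add_apply]
    omega
  refine ⟨fun m hm => ?_, ?_⟩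
  · rcases (key m).1 hm with h | h
    · exact le_max_of_le_left (hP.1 m h)
    · exact le_max_of_le_right (hQ.1 m h)
  · rcases le_total d e with h | h
    · obtain ⟨m, hm, hd⟩ := hQ.2
      exact ⟨m, (key m).2 (Or.inr hm), by rw [max_eq_right h, hd]⟩
    · obtain ⟨m, hm, hd⟩ := hP.2
      exact ⟨m, (key m).2 (Or.inl hm), by rw [max_eq_left h, hd]⟩

/-- The ring endomorphism sending `mon m` to `(-1) ^ ρ m • mon (m - ρ m • t)`. -/
noncomputable def signedProjection (ρ : Γ →+ ℤ) (t : Γ) :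
    AddMonoidAlgebra ℤ Γ →ₐ[ℤ] AddMonoidAlgebra ℤ Γ :=
  AddMonoidAlgebra.lift ℤ _ Γ
    { toFun := fun m => ((-1 : ℤˣ) ^ (ρ m.toAdd) : ℤˣ) • mon (m.toAdd - ρ m.toAdd • t)
      map_one' := by simp [one_def]
      map_mul' := fun m n => by
        have : m.toAdd + n.toAdd - (ρ m.toAdd + ρ n.toAdd) • t =
            (m.toAdd - ρ m.toAdd • t) + (n.toAdd - ρ n.toAdd • t) := by
          rw [add_smul]; abel
        rw [toAdd_mul, map_add, this, mon_add, zpow_add, smul_mul_smul_comm] }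

theorem signedProjection_mon (ρ : Γ →+ ℤ) (t m : Γ) :
    signedProjection ρ t (mon m) = ((-1 : ℤˣ) ^ (ρ m) : ℤˣ) • mon (m - ρ m • t) := by
  simp [signedProjection, mon]

/-- Modulo `1 + mon t`, the unit `mon t` equals -1, so a factor `mon (k • t)` may be traded for the
sign (-1)^k. -/
theorem dvd_sub_signedProjection (ρ : Γ →+ ℤ) (t : Γ) (P : AddMonoidAlgebra ℤ Γ) :
    1 + mon t ∣ P - signedProjection ρ t P := by
  have hu (k : ℤ) : 1 + mon t ∣ mon (k • t) - ((-1 : ℤˣ) ^ k : ℤˣ) • 1 := by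
    have step (k : ℤ) : mon ((k + 1) • t) - ((-1 : ℤˣ) ^ (k + 1) : ℤˣ) • 1 =
        mon (k • t) * (1 + mon t) - (mon (k • t) - ((-1 : ℤˣ) ^ k : ℤˣ) • 1) := by
      rw [add_smul, one_smul, mon_add, zpow_add, zpow_one, mul_neg, mul_one, Units.neg_smul]
      ring
    induction k with
    | zero => simp [mon_zero]
    | succ k ih =>
      rw [step]
      exact dvd_sub (dvd_mul_left _ _) ih
    | pred k ih =>
      have := step (-(k : ℤ) - 1)
      rw [sub_add_cancel] at this
      have h2 := dvd_sub (dvd_mul_left (1 + mon t) (mon ((-(k : ℤ) - 1) • t))) ih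
      rw [this] at h2
      simpa using h2
  induction P using AddMonoidAlgebra.induction_linear with
  | zero => simp
  | add P Q hP hQ =>
    rw [map_add, add_sub_add_comm]
    exact dvd_add hP hQ
  | single m r =>
    have h1 : single m r = r • mon m := by simp [mon, smul_single]
    have h2 : mon m - signedProjection ρ t (mon m) =
        mon (m - ρ m • t) * (mon (ρ m • t) - ((-1 : ℤˣ) ^ (ρ m) : ℤˣ) • 1) := by
      rw [signedProjection_mon, mul_sub, ← mon_add, sub_add_cancel, mul_smul_comm, mul_one]
    rw [h1, map_smul, ← smul_sub, h2]
    exact dvd_smul_of_dvd r ((hu _).mul_left _)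

theorem signedProjection_one_add {ρ : Γ →+ ℤ} {t : Γ} (h : ρ t = 1) :
    signedProjection ρ t (1 + mon t) = 0 := by
  rw [map_add, map_one, signedProjection_mon, h]
  simp [mon_zero]

/-- Up to a unit this is `1 + mon t` with t = B - A. Since ρ t = 1, the exponent t splits off and
setting `mon t` to -1 is a ring endomorphism. Its kernel consists of the multiples of `1 + mon t`,
and it takes values in a domain. -/
theorem prime_mon_add_mon [IsDomain (AddMonoidAlgebra ℤ Γ)] (ρ : Γ →+ ℤ) {A B : Γ}
    (h : ρ (B - A) = 1) : Prime (mon A + mon B) := by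
  have hu : IsUnit (mon A) := by
    refine IsUnit.of_mul_eq_one (mon (-A)) ?_
    rw [← mon_add, add_neg_cancel, mon_zero]
  have hassoc : mon A + mon B = mon A * (1 + mon (B - A)) := by
    rw [mul_add, mul_one, ← mon_add, add_sub_cancel]
  have hdvd (P : AddMonoidAlgebra ℤ Γ) :
      1 + mon (B - A) ∣ P ↔ signedProjection ρ (B - A) P = 0 := by
    constructor
    · rintro ⟨Q, rfl⟩
      rw [map_mul, signedProjection_one_add h, zero_mul]
    · intro h0
      simpa [h0] using dvd_sub_signedProjection ρ (B - A) P
  have hp : Prime (1 + mon (B - A)) := by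
    refine ⟨fun h0 => ?_, fun h1 => ?_, fun P Q hPQ => ?_⟩
    · have hne : (0 : Γ) ≠ B - A := by
        intro h'
        rw [← h'] at h
        simp at h
      have := congrArg (fun F => F.coeff 0) h0
      rw [← mon_zero, coeff_add, Finsupp.add_apply, coeff_mon_same, coeff_mon_ne hne.symm] at this
      simp at this
    · have := (hdvd 1).1 h1.dvd
      rw [map_one] at this
      exact one_ne_zero this
    · rw [hdvd, map_mul] at hPQ
      rw [hdvd, hdvd]
      exact mul_eq_zero.1 hPQ
  rw [hassoc]
  exact (associated_unit_mul_right _ _ hu).prime_iff.1 hp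

end GroupAlgebra

/-! ### The recurrence with all variables invertible, and degrees from its tropical form. -/

namespace Octahedron

open GroupAlgebra AddMonoidAlgebra

/-- Exponents of Laurent monomials in all face and edge variables. -/
abbrev LaurentExponent : Type := (FaceIndex →₀ ℤ) × (EdgeIndex →₀ ℤ)

/-- The ring of Laurent polynomials in all face and edge variables. -/
abbrev LaurentRing : Type := AddMonoidAlgebra ℤ LaurentExponent

/-- The fraction field of `LaurentRing`. -/
abbrev LaurentField : Type := FractionRing LaurentRing

/-- The exponent of the face variable with index `v`. -/
noncomputable def faceExp (v : FaceIndex) : LaurentExponent := (Finsupp.single v 1, 0)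

/-- The exponent of the edge variable with index `e`. -/
noncomputable def edgeExp (e : EdgeIndex) : LaurentExponent := (0, Finsupp.single e 1)

/-- The degree in the face variable with index `v`. -/
noncomputable def faceDeg (v : FaceIndex) : LaurentExponent →+ ℤ :=
  (Finsupp.applyAddHom v).comp (AddMonoidHom.fst _ _)

/-- The degree in the edge variable with index `e`. -/
noncomputable def edgeDeg (e : EdgeIndex) : LaurentExponent →+ ℤ :=
  (Finsupp.applyAddHom e).comp (AddMonoidHom.snd _ _)

theorem faceDeg_apply (v : FaceIndex) (m : LaurentExponent) : faceDeg v m = m.1 v := rfl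

theorem edgeDeg_apply (e : EdgeIndex) (m : LaurentExponent) : edgeDeg e m = m.2 e := rfl

theorem faceDeg_edgeExp (v : FaceIndex) (e : EdgeIndex) : faceDeg v (edgeExp e) = 0 := rfl

theorem edgeDeg_faceExp (v : FaceIndex) (e : EdgeIndex) : edgeDeg e (faceExp v) = 0 := rfl

theorem faceDeg_faceExp (v v' : FaceIndex) [Decidable (v' = v)] :
    faceDeg v (faceExp v') = if v' = v then 1 else 0 := by
  rw [faceDeg_apply, faceExp, Finsupp.single_apply]

theorem edgeDeg_edgeExp (e e' : EdgeIndex) [Decidable (e' = e)] :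
    edgeDeg e (edgeExp e') = if e' = e then 1 else 0 := by
  rw [edgeDeg_apply, edgeExp, Finsupp.single_apply]

namespace LatticePoint

/-- The exponent of the monomial `a c` in the octahedron relation with top `p`. -/
noncomputable def acExp (p : LatticePoint) : LaurentExponent := edgeExp p.edgeA + edgeExp p.edgeC

/-- The exponent of the monomial `b d` in the octahedron relation with top `p`. -/
noncomputable def bdExp (p : LatticePoint) : LaurentExponent := edgeExp p.edgeB + edgeExp p.edgeD

end LatticePoint

namespace HeightFunction

variable (h : HeightFunction)

open Classical in
/-- The solution of the octahedron recurrence in the field `LaurentField`. -/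
noncomputable def g (p : LatticePoint) : LaurentField :=
  if _hp : h p.i p.j < p.n then
    (algebraMap LaurentRing LaurentField (mon p.acExp) * g p.north * g p.south +
      algebraMap LaurentRing LaurentField (mon p.bdExp) * g p.east * g p.west) / g p.below
  else algebraMap LaurentRing LaurentField (mon (faceExp (p.i, p.j)))
termination_by (h.coneAbove p).ncard
decreasing_by
  all_goals
    refine h.ncard_coneAbove_lt _hp ?_ ?_ <;>
    simp [LatticePoint.north, LatticePoint.south, LatticePoint.east, LatticePoint.west,
      LatticePoint.below]

theorem apply_right (i j : ℤ) : h (i + 1) j = h i j + 1 ∨ h (i + 1) j = h i j - 1 := by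
  have := h.adjacent (i + 1) j i j (by simp)
  rcases (abs_eq zero_le_one).1 this with h | h <;> omega

theorem apply_up (i j : ℤ) : h i (j + 1) = h i j + 1 ∨ h i (j + 1) = h i j - 1 := by
  have := h.adjacent i (j + 1) i j (by simp)
  rcases (abs_eq zero_le_one).1 this with h | h <;> omega

theorem le_sub_two {p : LatticePoint} (hp : h p.i p.j < p.n) : h p.i p.j ≤ p.n - 2 := by
  have h1 := h.parity p.i p.j
  have h2 := p.parity
  grind

theorem le_below {p : LatticePoint} (hp : h p.i p.j < p.n) :
    h p.below.i p.below.j ≤ p.below.n := h.le_sub_two hp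

theorem le_north {p : LatticePoint} (hp : h p.i p.j < p.n) :
    h p.north.i p.north.j ≤ p.north.n := by
  have h1 := h.le_sub_two hp
  have h2 := h.apply_up p.i p.j
  simp only [LatticePoint.north]
  omega

theorem le_south {p : LatticePoint} (hp : h p.i p.j < p.n) :
    h p.south.i p.south.j ≤ p.south.n := by
  have h1 := h.le_sub_two hp
  have h2 := h.apply_up p.i (p.j - 1)
  rw [sub_add_cancel] at h2
  simp only [LatticePoint.south]
  omega

theorem le_east {p : LatticePoint} (hp : h p.i p.j < p.n) :
    h p.east.i p.east.j ≤ p.east.n := by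
  have h1 := h.le_sub_two hp
  have h2 := h.apply_right p.i p.j
  simp only [LatticePoint.east]
  omega

theorem le_west {p : LatticePoint} (hp : h p.i p.j < p.n) :
    h p.west.i p.west.j ≤ p.west.n := by
  have h1 := h.le_sub_two hp
  have h2 := h.apply_right (p.i - 1) p.j
  rw [sub_add_cancel] at h2
  simp only [LatticePoint.west]
  omega

/-- Induction along the octahedron recurrence. -/
theorem octahedron_induction {motive : LatticePoint → Prop}
    (init : ∀ q, h q.i q.j = q.n → motive q)
    (step : ∀ q, h q.i q.j < q.n → motive q.north → motive q.south → motive q.east →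
      motive q.west → motive q.below → motive q)
    (q : LatticePoint) (hq : h q.i q.j ≤ q.n) : motive q := by
  induction hN : (h.coneAbove q).ncard using Nat.strong_induction_on generalizing q with
  | _ N ih =>
    rcases hq.eq_or_lt with h0 | h0
    · exact init q h0
    · have key (r : LatticePoint) (hr : h r.i r.j ≤ r.n) (h1 : r.n < q.n)
          (h2 : r.n ≤ q.n - |r.i - q.i| - |r.j - q.j|) : motive r :=
        ih _ (hN ▸ h.ncard_coneAbove_lt h0 h1 h2) r hr rfl
      refine step q h0 (key _ (h.le_north h0) ?_ ?_) (key _ (h.le_south h0) ?_ ?_)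
        (key _ (h.le_east h0) ?_ ?_) (key _ (h.le_west h0) ?_ ?_)
        (key _ (h.le_below h0) ?_ ?_) <;>
      simp [LatticePoint.north, LatticePoint.south, LatticePoint.east, LatticePoint.west,
        LatticePoint.below]

end HeightFunction

/-- `r` is a quotient of two Laurent polynomials with nonnegative coefficients, whose maximal
degrees under the grading `w` differ by `d`. -/
def HasFractionDeg (w : LaurentExponent →+ ℤ) (r : LaurentField) (d : ℤ) : Prop :=
  ∃ P ∈ nonnegative LaurentExponent, ∃ Q ∈ nonnegative LaurentExponent, ∃ k l : ℤ,
    HasMaxDeg w P k ∧ HasMaxDeg w Q l ∧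
      r * algebraMap LaurentRing LaurentField Q = algebraMap LaurentRing LaurentField P ∧
      d = k - l

theorem algebraMap_injective :
    Function.Injective (algebraMap LaurentRing LaurentField) :=
  IsFractionRing.injective LaurentRing LaurentField

namespace HasFractionDeg

variable {w : LaurentExponent →+ ℤ} {r s : LaurentField} {d e : ℤ}

theorem ne_zero (hr : HasFractionDeg w r d) : r ≠ 0 := by
  rintro rfl
  obtain ⟨P, -, Q, -, k, l, hP, -, h, -⟩ := hr
  rw [zero_mul, eq_comm, map_eq_zero_iff _ algebraMap_injective] at h
  exact hP.ne_zero h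

theorem mul (hr : HasFractionDeg w r d) (hs : HasFractionDeg w s e) :
    HasFractionDeg w (r * s) (d + e) := by
  obtain ⟨P, hP0, Q, hQ0, k, l, hP, hQ, h, rfl⟩ := hr
  obtain ⟨P', hP0', Q', hQ0', k', l', hP', hQ', h', rfl⟩ := hs
  refine ⟨P * P', mul_mem hP0 hP0', Q * Q', mul_mem hQ0 hQ0', _, _, hP.mul hP', hQ.mul hQ', ?_,
    by ring⟩
  rw [map_mul, map_mul, ← h, ← h']
  ring

theorem inv (hr : HasFractionDeg w r d) : HasFractionDeg w r⁻¹ (-d) := by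
  have h0 := hr.ne_zero
  obtain ⟨P, hP0, Q, hQ0, k, l, hP, hQ, h, rfl⟩ := hr
  exact ⟨Q, hQ0, P, hP0, l, k, hQ, hP, by rw [← h, inv_mul_cancel_left₀ h0], by ring⟩

theorem add (hr : HasFractionDeg w r d) (hs : HasFractionDeg w s e) :
    HasFractionDeg w (r + s) (max d e) := by
  obtain ⟨P, hP0, Q, hQ0, k, l, hP, hQ, h, rfl⟩ := hr
  obtain ⟨P', hP0', Q', hQ0', k', l', hP', hQ', h', rfl⟩ := hs
  refine ⟨P * Q' + P' * Q, add_mem (mul_mem hP0 hQ0') (mul_mem hP0' hQ0), Q * Q',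
    mul_mem hQ0 hQ0', _, _, (hP.mul hQ').add (hP'.mul hQ) (mul_mem hP0 hQ0') (mul_mem hP0' hQ0),
    hQ.mul hQ', ?_, by omega⟩
  rw [map_add, map_mul, map_mul, map_mul, ← h, ← h']
  ring

end HasFractionDeg

theorem hasFractionDeg_mon (w : LaurentExponent →+ ℤ) (m : LaurentExponent) :
    HasFractionDeg w (algebraMap LaurentRing LaurentField (mon m)) (w m) :=
  ⟨mon m, mon_mem_nonnegative m, mon 0, mon_mem_nonnegative 0, _, _, hasMaxDeg_mon w m,
    hasMaxDeg_mon w 0, by rw [mon_zero, map_one, mul_one], by simp⟩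

/-- Maximal degrees add under multiplication, so the degree of F can be read off from F * Q = P. -/
theorem HasFractionDeg.hasMaxDeg {w : LaurentExponent →+ ℤ} {F : LaurentRing} {d : ℤ}
    (hF : HasFractionDeg w (algebraMap LaurentRing LaurentField F) d) : HasMaxDeg w F d := by
  have h0 : F ≠ 0 := fun h => hF.ne_zero (by rw [h, map_zero])
  obtain ⟨P, -, Q, -, k, l, hP, hQ, h, rfl⟩ := hF
  rw [← map_mul] at h
  obtain ⟨e, he⟩ := exists_hasMaxDeg w h0
  have h1 := he.mul hQ
  rw [algebraMap_injective h] at h1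
  rwa [hP.unique h1, add_sub_cancel_right]

namespace HeightFunction

variable (h : HeightFunction)

theorem g_of_not_lt {p : LatticePoint} (hp : ¬ h p.i p.j < p.n) :
    h.g p = algebraMap LaurentRing LaurentField (mon (faceExp (p.i, p.j))) := by
  rw [g, dif_neg hp]

/-- If `D` satisfies the tropical octahedron recurrence for the grading `w`, then it gives the
maximal degrees of the values of `g`. -/
theorem hasFractionDeg_g {w : LaurentExponent →+ ℤ} {D : LatticePoint → ℤ}
    (init : ∀ q, h q.i q.j = q.n → D q = w (faceExp (q.i, q.j)))
    (step : ∀ q, h q.i q.j < q.n → D q + D q.below =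
      max (w q.acExp + D q.north + D q.south) (w q.bdExp + D q.east + D q.west))
    (q : LatticePoint) (hq : h q.i q.j ≤ q.n) : HasFractionDeg w (h.g q) (D q) := by
  refine h.octahedron_induction (motive := fun q => HasFractionDeg w (h.g q) (D q))
    (fun q h0 => ?_) (fun q h0 hN hS hE hW hB => ?_) q hq
  · rw [init q h0, g_of_not_lt _ (by omega)]
    exact hasFractionDeg_mon _ _
  · rw [g, dif_pos h0, eq_sub_of_add_eq (step q h0), div_eq_mul_inv]
    exact ((((hasFractionDeg_mon w _).mul hN).mul hS).add
      (((hasFractionDeg_mon w _).mul hE).mul hW)).mul hB.inv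

theorem g_ne_zero (q : LatticePoint) : h.g q ≠ 0 := by
  by_cases hq : h q.i q.j ≤ q.n
  -- The trivial grading suffices: having any fraction degree at all implies being nonzero.
  · exact (h.hasFractionDeg_g (w := 0) (D := 0) (by simp) (by simp) q hq).ne_zero
  · rw [h.g_of_not_lt (by omega)]
    exact (map_ne_zero_iff _ algebraMap_injective).2 (mon_ne_zero _)

theorem g_mul_g_below {p : LatticePoint} (hp : h p.i p.j < p.n) :
    h.g p * h.g p.below =
      algebraMap LaurentRing LaurentField (mon p.acExp) * h.g p.north * h.g p.south +
      algebraMap LaurentRing LaurentField (mon p.bdExp) * h.g p.east * h.g p.west := by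
  rw [g, dif_pos hp, div_mul_cancel₀ _ (h.g_ne_zero _)]

/-- In each relation a given edge variable is missing from at least one of the products a c and b d.
Hence 0 solves the tropical recurrence for the negated degree in that variable. -/
theorem edgeDeg_nonneg {q : LatticePoint} (hq : h q.i q.j ≤ q.n) {F : LaurentRing}
    (hF : algebraMap LaurentRing LaurentField F = h.g q) (e : EdgeIndex) {m : LaurentExponent}
    (hm : F.coeff m ≠ 0) : 0 ≤ edgeDeg e m := by
  classical
  have hd := h.hasFractionDeg_g (w := -edgeDeg e) (D := fun _ => 0) ?_ ?_ q hq
  · rw [← hF] at hd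
    simpa using hd.hasMaxDeg.1 m hm
  · intro q _
    simp [edgeDeg_faceExp]
  · intro q _
    simp only [LatticePoint.acExp, LatticePoint.bdExp, AddMonoidHom.neg_apply, map_add,
      edgeDeg_edgeExp]
    obtain ⟨i, j, t, he⟩ := e
    cases t <;> simp only [LatticePoint.edgeA, LatticePoint.edgeB, LatticePoint.edgeC,
      LatticePoint.edgeD, EdgeIndex.mk.injEq, reduceCtorEq, and_false, if_false] <;>
      split_ifs <;> simp

end HeightFunction

end Octahedron

/-! ### Cone and point indicators as tropical solutions, in coordinates relative to `u`. -/

namespace Octahedron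

/-- The indicator function of the cone `|i| + |j| ≤ n`. -/
def coneInd (n i j : ℤ) : ℤ := if |i| + |j| ≤ n then 1 else 0

/-- The indicator function of the point `(m, 0, 0)`. -/
def pointInd (m n i j : ℤ) : ℤ := if n = m ∧ i = 0 ∧ j = 0 then 1 else 0

theorem coneInd_comm (n i j : ℤ) : coneInd n i j = coneInd n j i := by
  rw [coneInd, coneInd, add_comm]

theorem coneInd_nonneg (n i j : ℤ) : 0 ≤ coneInd n i j := by
  rw [coneInd]
  split_ifs <;> simp

theorem coneInd_le_one (n i j : ℤ) : coneInd n i j ≤ 1 := by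
  rw [coneInd]
  split_ifs <;> simp

theorem coneInd_mono {m n : ℤ} (h : m ≤ n) (i j : ℤ) : coneInd m i j ≤ coneInd n i j := by
  simp only [coneInd]
  split_ifs <;> omega

theorem coneInd_eq_zero {n i j : ℤ} (h : n < |i| + |j|) : coneInd n i j = 0 :=
  if_neg (by omega)

/-- For j ≠ 0 the numbers |j + 1| and |j - 1| are |j| + 1 and |j| - 1 in some order, so the cone
conditions match in pairs. -/
theorem coneInd_succ_add_pred {j : ℤ} (hj : j ≠ 0) (n i : ℤ) :
    coneInd (n - 1) i (j + 1) + coneInd (n - 1) i (j - 1) =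
      coneInd n i j + coneInd (n - 2) i j := by
  have h1 := abs_cases j
  have h2 := abs_cases (j + 1)
  have h3 := abs_cases (j - 1)
  simp only [coneInd]
  rcases lt_or_gt_of_ne hj with h | h
  · congr 1 <;> exact if_congr (by omega) rfl rfl
  · rw [add_comm]
    congr 1 <;> exact if_congr (by omega) rfl rfl

theorem coneInd_succ_add_pred_zero (n i : ℤ) :
    coneInd (n - 1) i (0 + 1) + coneInd (n - 1) i (0 - 1) =
      coneInd (n - 2) i 0 + coneInd (n - 2) i 0 := by
  have h0 : |(0 : ℤ)| = 0 := rfl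
  have h1 : |(0 : ℤ) + 1| = 1 := rfl
  have h2 : |(0 : ℤ) - 1| = 1 := rfl
  simp only [coneInd]
  congr 1 <;> exact if_congr (by omega) rfl rfl

/-- Off the plane j = 0 the cone indicator solves the recurrence without edge terms. On j = 0 the
defect sits on the lines i = n and i = -n, exactly where the variables a and c being counted occur.
These lines meet at the origin, where the point indicator supplies the missing unit. -/
theorem coneInd_add_pointInd_step {n i j : ℤ} (hpar : (n + i + j) % 2 = 0)
    (hpos : 2 ≤ n + |i| + |j| ∨ (i = 0 ∧ j = 0 ∧ 0 ≤ n)) :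
    coneInd n i j + pointInd (-2) n i j + (coneInd (n - 2) i j + pointInd (-2) (n - 2) i j) =
      (if j = 0 ∧ n + i = 0 then 1 else 0) + (if j = 0 ∧ i = n then 1 else 0) +
        (coneInd (n - 1) i (j + 1) + pointInd (-2) (n - 1) i (j + 1)) +
        (coneInd (n - 1) i (j - 1) + pointInd (-2) (n - 1) i (j - 1)) := by
  have hi := abs_cases i
  have hj := abs_cases j
  have e1 : pointInd (-2) n i j = 0 := if_neg (by omega)
  have e2 : pointInd (-2) (n - 1) i (j + 1) = 0 := if_neg (by omega)
  have e3 : pointInd (-2) (n - 1) i (j - 1) = 0 := if_neg (by omega)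
  rw [e1, e2, e3]
  by_cases h0 : j = 0
  · subst h0
    have h1 := coneInd_succ_add_pred_zero n i
    have h2 : coneInd n i 0 + pointInd (-2) (n - 2) i 0 = coneInd (n - 2) i 0 +
        ((if n + i = 0 then 1 else 0) + (if i = n then 1 else 0)) := by
      clear h1 e1 e2 e3
      simp only [coneInd, pointInd, abs_zero, and_true, true_and, add_zero] at *
      generalize |i| = a at *
      split_ifs <;> omega
    simp only [true_and]
    omega
  · have h1 := coneInd_succ_add_pred h0 n i
    rw [if_neg (by omega), if_neg (by omega),
      show pointInd (-2) (n - 2) i j = 0 from if_neg (by omega)]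
    omega

/-- The function is the maximal degree in x: 1 at the point below `u`, -1 at `u`, and 1 on the cone
whose vertex is two levels above `u`. The two products tie, except on a coordinate axis away from
the origin, where the pair along the axis dominates. -/
theorem coneInd_sub_pointInd_step {n i j : ℤ} (hpar : (n + i + j) % 2 = 0)
    (hpos : 2 ≤ n + |i| + |j| ∨ (i = 0 ∧ j = 0 ∧ 0 ≤ n)) :
    coneInd (n - 2) i j - pointInd 0 n i j + pointInd (-2) n i j +
        (coneInd (n - 2 - 2) i j - pointInd 0 (n - 2) i j + pointInd (-2) (n - 2) i j) =
      max ((coneInd (n - 1 - 2) i (j + 1) - pointInd 0 (n - 1) i (j + 1) +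
          pointInd (-2) (n - 1) i (j + 1)) +
        (coneInd (n - 1 - 2) i (j - 1) - pointInd 0 (n - 1) i (j - 1) +
          pointInd (-2) (n - 1) i (j - 1)))
        ((coneInd (n - 1 - 2) (i + 1) j - pointInd 0 (n - 1) (i + 1) j +
          pointInd (-2) (n - 1) (i + 1) j) +
        (coneInd (n - 1 - 2) (i - 1) j - pointInd 0 (n - 1) (i - 1) j +
          pointInd (-2) (n - 1) (i - 1) j)) := by
  have hi := abs_cases i
  have hj := abs_cases j
  have e1 : pointInd (-2) n i j = 0 := if_neg (by omega)
  have e2 : pointInd (-2) (n - 1) i (j + 1) = 0 := if_neg (by omega)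
  have e3 : pointInd (-2) (n - 1) i (j - 1) = 0 := if_neg (by omega)
  have e4 : pointInd (-2) (n - 1) (i + 1) j = 0 := if_neg (by omega)
  have e5 : pointInd (-2) (n - 1) (i - 1) j = 0 := if_neg (by omega)
  rw [e1, e2, e3, e4, e5, show n - 1 - 2 = n - 2 - 1 by ring]
  have m1 := coneInd_mono (show n - 2 - 2 ≤ n - 2 by omega) i j
  have z1 : n < |i| + |j| + 2 → coneInd (n - 2) i j = 0 := fun h => coneInd_eq_zero (by omega)
  have z2 : n < |i| + |j| + 4 → coneInd (n - 2 - 2) i j = 0 :=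
    fun h => coneInd_eq_zero (by omega)
  by_cases h0 : j = 0 <;> by_cases h0' : i = 0
  · subst h0 h0'
    rw [coneInd_comm _ (0 + 1), coneInd_comm _ (0 - 1)]
    have h1 := coneInd_succ_add_pred_zero (n - 2) 0
    have h2 : coneInd (n - 2) 0 0 - pointInd 0 n 0 0 - pointInd 0 (n - 2) 0 0 +
        pointInd (-2) (n - 2) 0 0 = coneInd (n - 2 - 2) 0 0 := by
      simp only [coneInd, pointInd, abs_zero, and_true, add_zero] at hpos ⊢
      split_ifs <;> omega
    have h3 (i j) (h : i ≠ 0 ∨ j ≠ 0) : pointInd 0 (n - 1) i j = 0 := if_neg (by omega)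
    rw [h3 _ _ (by omega), h3 _ _ (by omega), h3 _ _ (by omega), h3 _ _ (by omega)]
    omega
  · subst h0
    have h1 := coneInd_succ_add_pred_zero (n - 2) i
    have h2 := coneInd_succ_add_pred h0' (n - 2) 0
    rw [coneInd_comm _ 0, coneInd_comm _ 0, coneInd_comm _ 0, coneInd_comm _ 0] at h2
    rw [abs_zero] at *
    have h3 (i j) (h : i ≠ 0 ∨ j ≠ 0) (m n) : pointInd m n i j = 0 := if_neg (by omega)
    rw [h3 _ _ (by omega), h3 _ _ (by omega), h3 _ _ (by omega), h3 _ _ (by omega),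
      h3 _ _ (by omega)]
    simp only [pointInd]
    split_ifs <;> omega
  · subst h0'
    have h1 := coneInd_succ_add_pred_zero (n - 2) j
    have h2 := coneInd_succ_add_pred h0 (n - 2) 0
    rw [coneInd_comm _ j, coneInd_comm _ j, coneInd_comm _ j] at h1
    rw [abs_zero] at *
    have h3 (i j) (h : i ≠ 0 ∨ j ≠ 0) (m n) : pointInd m n i j = 0 := if_neg (by omega)
    rw [h3 0 j (by omega), h3 0 j (by omega), h3 0 j (by omega), h3 _ j (by omega),
      h3 _ j (by omega)]
    simp only [pointInd]
    split_ifs <;> omega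
  · have h1 := coneInd_succ_add_pred h0 (n - 2) i
    have h2 := coneInd_succ_add_pred h0' (n - 2) j
    rw [coneInd_comm _ j, coneInd_comm _ j, coneInd_comm _ j, coneInd_comm _ j] at h2
    have h3 (i j) (h : i ≠ 0 ∨ j ≠ 0) (m n) : pointInd m n i j = 0 := if_neg (by omega)
    simp only [h3 i _ (Or.inl h0'), h3 _ j (Or.inr h0)]
    omega

end Octahedron

/-! ### Raising a local minimum, and the weight attached to it. -/

namespace Octahedron

open GroupAlgebra AddMonoidAlgebra

/-- `u` is the top of an octahedron whose other five lower vertices lie on the surface given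
by `h`, so that `(u.i, u.j)` is a local minimum of `h`. -/
structure IsLowest (h : HeightFunction) (u : LatticePoint) : Prop where
  center : h u.i u.j = u.n - 2
  north : h u.i (u.j + 1) = u.n - 1
  south : h u.i (u.j - 1) = u.n - 1
  east : h (u.i + 1) u.j = u.n - 1
  west : h (u.i - 1) u.j = u.n - 1

/-- The point `q` lies in the downward cone with vertex `p`. -/
def InCone (p q : LatticePoint) : Prop := q.n ≤ p.n - |q.i - p.i| - |q.j - p.j|

theorem InCone.refl (p : LatticePoint) : InCone p p := by simp [InCone]

theorem InCone.trans {p q r : LatticePoint} (h1 : InCone p q) (h2 : InCone q r) :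
    InCone p r := by
  have h3 := abs_sub_le r.i q.i p.i
  have h4 := abs_sub_le r.j q.j p.j
  simp only [InCone] at *
  linarith

theorem inCone_north (p : LatticePoint) : InCone p p.north := by simp [InCone, LatticePoint.north]
theorem inCone_south (p : LatticePoint) : InCone p p.south := by simp [InCone, LatticePoint.south]
theorem inCone_east (p : LatticePoint) : InCone p p.east := by simp [InCone, LatticePoint.east]
theorem inCone_west (p : LatticePoint) : InCone p p.west := by simp [InCone, LatticePoint.west]
theorem inCone_below (p : LatticePoint) : InCone p p.below := by simp [InCone, LatticePoint.below]

theorem le_add_abs_sub {φ : ℤ → ℤ} (hφ : ∀ i, φ (i + 1) = φ i + 1 ∨ φ (i + 1) = φ i - 1)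
    (i k : ℤ) : φ i ≤ φ k + |i - k| := by
  have key (n : ℕ) (i : ℤ) : φ (i + n) ≤ φ i + n ∧ φ i ≤ φ (i + n) + n := by
    induction n with
    | zero => simp
    | succ n ih =>
      have := hφ (i + n)
      push_cast
      rw [← add_assoc]
      omega
  rcases le_total i k with h | h
  · have := key (k - i).toNat i
    rw [Int.toNat_of_nonneg (by omega), add_sub_cancel] at this
    rw [abs_of_nonpos (by omega)]
    omega
  · have := key (i - k).toNat k
    rw [Int.toNat_of_nonneg (by omega), add_sub_cancel] at this
    rw [abs_of_nonneg (by omega)]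
    omega

namespace HeightFunction

variable (h : HeightFunction)

theorem le_add_dist (i j k l : ℤ) : h i j ≤ h k l + |i - k| + |j - l| := by
  have h1 := le_add_abs_sub (φ := fun t => h t j) (fun t => h.apply_right t j) i k
  have h2 := le_add_abs_sub (φ := fun t => h k t) (fun t => h.apply_up k t) j l
  omega

/-- Take a point of least height above the surface in the cone. Its five lower neighbours are in the
cone and lower still, so not above the surface; being also not below it, they lie on it. -/
theorem exists_isLowest {p : LatticePoint} (hp : h p.i p.j < p.n) :
    ∃ u, InCone p u ∧ IsLowest h u := by
  obtain ⟨u, ⟨hu, hlt⟩, hmin⟩ := Set.exists_min_image (h.coneAbove p) LatticePoint.n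
    (h.coneAbove_finite p) ⟨p, InCone.refl p, hp⟩
  have key (r : LatticePoint) (h1 : InCone u r) (h2 : r.n < u.n) : r.n ≤ h r.i r.j := by
    by_contra! hc
    have := hmin r ⟨InCone.trans hu h1, hc⟩
    omega
  have hB := key _ (inCone_below u) (by simp [LatticePoint.below])
  have hN := key _ (inCone_north u) (by simp [LatticePoint.north])
  have hS := key _ (inCone_south u) (by simp [LatticePoint.south])
  have hE := key _ (inCone_east u) (by simp [LatticePoint.east])
  have hW := key _ (inCone_west u) (by simp [LatticePoint.west])
  have hB' := h.le_below hlt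
  have hN' := h.le_north hlt
  have hS' := h.le_south hlt
  have hE' := h.le_east hlt
  have hW' := h.le_west hlt
  exact ⟨u, hu, le_antisymm hB' hB, le_antisymm hN' hN, le_antisymm hS' hS,
    le_antisymm hE' hE, le_antisymm hW' hW⟩

end HeightFunction

variable {h : HeightFunction} {u : LatticePoint}

open Classical in
/-- The height function obtained from `h` by raising the local minimum below `u` to `u`. -/
noncomputable def raise (hu : IsLowest h u) : HeightFunction where
  toFun i j := if i = u.i ∧ j = u.j then u.n else h i j
  adjacent i₁ j₁ i₂ j₂ hd := by
    have nbr (i j : ℤ) (hd : |i - u.i| + |j - u.j| = 1) : h i j = u.n - 1 := by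
      have : (i = u.i ∧ j = u.j + 1) ∨ (i = u.i ∧ j = u.j - 1) ∨ (i = u.i + 1 ∧ j = u.j) ∨
          (i = u.i - 1 ∧ j = u.j) := by
        have h1 := abs_cases (i - u.i)
        have h2 := abs_cases (j - u.j)
        omega
      rcases this with ⟨rfl, rfl⟩ | ⟨rfl, rfl⟩ | ⟨rfl, rfl⟩ | ⟨rfl, rfl⟩
      exacts [hu.north, hu.south, hu.east, hu.west]
    split_ifs with h1 h2 h2
    · simp [h1.1, h1.2, h2.1, h2.2] at hd
    · rw [abs_sub_comm i₁, abs_sub_comm j₁, h1.1, h1.2] at hd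
      rw [nbr _ _ hd]
      simp
    · rw [h2.1, h2.2] at hd
      rw [nbr _ _ hd]
      simp
    · exact h.adjacent _ _ _ _ hd
  parity i j := by
    split_ifs with h1
    · rw [h1.1, h1.2]
      exact u.parity
    · exact h.parity i j
  tendsto := by
    refine Filter.tendsto_atTop_mono (fun v => ?_) h.tendsto
    have := hu.center
    split_ifs with h1
    · rw [h1.1, h1.2]
      omega
    · exact le_rfl

theorem raise_center (hu : IsLowest h u) : raise hu u.i u.j = u.n := by
  simp [raise]

theorem raise_apply (hu : IsLowest h u) {i j : ℤ} (hij : ¬(i = u.i ∧ j = u.j)) :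
    raise hu i j = h i j := by
  simp [raise, hij]

theorem le_raise (hu : IsLowest h u) (i j : ℤ) : h i j ≤ raise hu i j := by
  have := hu.center
  by_cases hij : i = u.i ∧ j = u.j
  · rw [hij.1, hij.2, raise_center]
    omega
  · rw [raise_apply hu hij]

theorem IsLowest.le_dist_sub_two (hu : IsLowest h u) (i j : ℤ) :
    h i j ≤ u.n - 2 + |i - u.i| + |j - u.j| :=
  hu.center ▸ h.le_add_dist i j u.i u.j

/-- One of the four neighbours of the minimum is one step closer to (i, j), and it has height `u.n -
1`. -/
theorem IsLowest.sub_dist_le (hu : IsLowest h u) {i j : ℤ} (hij : ¬(i = u.i ∧ j = u.j)) :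
    u.n - |i - u.i| - |j - u.j| ≤ h i j := by
  have h1 := h.le_add_dist u.i (u.j + 1) i j
  have h2 := h.le_add_dist u.i (u.j - 1) i j
  have h3 := h.le_add_dist (u.i + 1) u.j i j
  have h4 := h.le_add_dist (u.i - 1) u.j i j
  rw [hu.north] at h1
  rw [hu.south] at h2
  rw [hu.east] at h3
  rw [hu.west] at h4
  have c1 := abs_cases (u.j + 1 - j)
  have c2 := abs_cases (u.j - 1 - j)
  have c3 := abs_cases (u.i + 1 - i)
  have c4 := abs_cases (u.i - 1 - i)
  have c5 := abs_cases (u.i - i)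
  have c6 := abs_cases (u.j - j)
  rw [abs_sub_comm i, abs_sub_comm j]
  omega

theorem raise_le (hu : IsLowest h u) {q : LatticePoint} (hq : h q.i q.j < q.n)
    (hqu : InCone q u) : raise hu q.i q.j ≤ q.n := by
  by_cases hij : q.i = u.i ∧ q.j = u.j
  · rw [hij.1, hij.2, raise_center]
    rw [InCone, ← hij.1, ← hij.2] at hqu
    simpa using hqu
  · rw [raise_apply hu hij]
    exact hq.le

theorem ncard_raise_lt (hu : IsLowest h u) {p q : LatticePoint} (hpu : InCone p u)
    (hpq : InCone p q) : ((raise hu).coneAbove q).ncard < (h.coneAbove p).ncard := by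
  refine Set.ncard_lt_ncard ⟨?_, fun hs => ?_⟩ (h.coneAbove_finite p)
  · rintro r ⟨h1, h2⟩
    exact ⟨InCone.trans hpq h1, (le_raise hu _ _).trans_lt h2⟩
  · have := (hs (⟨hpu, by rw [hu.center]; omega⟩ : u ∈ h.coneAbove p)).2
    rw [raise_center] at this
    omega

/-- The grading that counts the face variable below `u` and the four edge variables around it. -/
noncomputable def weight (u : LatticePoint) : LaurentExponent →+ ℤ :=
  faceDeg (u.i, u.j) + edgeDeg u.edgeA + edgeDeg u.edgeB + edgeDeg u.edgeC + edgeDeg u.edgeD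

/-- The weight of the value at `q` of the solution of the octahedron recurrence. -/
def weightAt (u q : LatticePoint) : ℤ :=
  coneInd (q.n - u.n) (q.i - u.i) (q.j - u.j) + pointInd (-2) (q.n - u.n) (q.i - u.i) (q.j - u.j)

theorem weightAt_le_one (u q : LatticePoint) : weightAt u q ≤ 1 := by
  rw [weightAt]
  have h1 := coneInd_le_one (q.n - u.n) (q.i - u.i) (q.j - u.j)
  by_cases h0 : q.n - u.n = -2 ∧ q.i - u.i = 0 ∧ q.j - u.j = 0
  · rw [coneInd_eq_zero (by rw [h0.1, h0.2.1, h0.2.2]; simp), pointInd, if_pos h0]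
    simp
  · rw [pointInd, if_neg h0]
    omega

theorem weight_faceExp (u : LatticePoint) (i j : ℤ) [Decidable (i = u.i ∧ j = u.j)] :
    weight u (faceExp (i, j)) = if i = u.i ∧ j = u.j then 1 else 0 := by
  classical
  simp [weight, edgeDeg_faceExp, faceDeg_faceExp]

theorem weight_acExp (u q : LatticePoint) : weight u q.acExp =
    (if q.j - u.j = 0 ∧ (q.n - u.n) + (q.i - u.i) = 0 then 1 else 0) +
      (if q.j - u.j = 0 ∧ q.i - u.i = q.n - u.n then 1 else 0) := by
  classical
  simp only [weight, LatticePoint.acExp, AddMonoidHom.add_apply, map_add, faceDeg_edgeExp,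
    edgeDeg_edgeExp, LatticePoint.edgeA, LatticePoint.edgeB, LatticePoint.edgeC,
    LatticePoint.edgeD, EdgeIndex.mk.injEq, reduceCtorEq, and_false, and_true, if_false,
    add_zero, zero_add]
  congr 1 <;> exact if_congr (by omega) rfl rfl

theorem weight_bdExp (u q : LatticePoint) : weight u q.bdExp =
    (if q.i - u.i = 0 ∧ (q.n - u.n) + (q.j - u.j) = 0 then 1 else 0) +
      (if q.i - u.i = 0 ∧ q.j - u.j = q.n - u.n then 1 else 0) := by
  classical
  simp only [weight, LatticePoint.bdExp, AddMonoidHom.add_apply, map_add, faceDeg_edgeExp,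
    edgeDeg_edgeExp, LatticePoint.edgeA, LatticePoint.edgeB, LatticePoint.edgeC,
    LatticePoint.edgeD, EdgeIndex.mk.injEq, reduceCtorEq, and_false, and_true, if_false,
    add_zero, zero_add]
  congr 1 <;> exact if_congr (by omega) rfl rfl

/-- The conditions under which the position of a lattice point relative to `u` is admissible in
the tropical recurrences. -/
theorem IsLowest.position (hu : IsLowest h u) {q : LatticePoint} (hq : h q.i q.j < q.n) :
    ((q.n - u.n) + (q.i - u.i) + (q.j - u.j)) % 2 = 0 ∧
      (2 ≤ (q.n - u.n) + |q.i - u.i| + |q.j - u.j| ∨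
        (q.i - u.i = 0 ∧ q.j - u.j = 0 ∧ 0 ≤ q.n - u.n)) := by
  have h1 := Int.even_iff.1 q.parity
  have h2 := Int.even_iff.1 u.parity
  have h3 := h.le_sub_two hq
  refine ⟨by omega, ?_⟩
  by_cases hij : q.i = u.i ∧ q.j = u.j
  · rw [hij.1, hij.2, hu.center] at h3
    omega
  · have := hu.sub_dist_le hij
    omega

/-- The two terms tie in weight, which makes the values homogeneous. The second equation is the
first with the coordinates i and j exchanged. -/
theorem weightAt_step (hu : IsLowest h u) {q : LatticePoint} (hq : h q.i q.j < q.n) :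
    weightAt u q + weightAt u q.below =
        weight u q.acExp + weightAt u q.north + weightAt u q.south ∧
      weightAt u q + weightAt u q.below =
        weight u q.bdExp + weightAt u q.east + weightAt u q.west := by
  obtain ⟨h1, h2⟩ := hu.position hq
  have h3 := coneInd_add_pointInd_step h1 h2
  have h4 := coneInd_add_pointInd_step (n := q.n - u.n) (i := q.j - u.j) (j := q.i - u.i)
    (by omega) (by omega)
  have hc (m n i j) : pointInd m n i j = pointInd m n j i := if_congr (by omega) rfl rfl
  simp only [coneInd_comm _ (q.j - u.j), hc _ _ (q.j - u.j)] at h4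
  rw [weight_acExp, weight_bdExp]
  simp only [weightAt, LatticePoint.north, LatticePoint.south, LatticePoint.east,
    LatticePoint.west, LatticePoint.below, sub_right_comm _ _ u.n, sub_right_comm _ _ u.i,
    sub_right_comm _ _ u.j, add_sub_right_comm _ _ u.i, add_sub_right_comm _ _ u.j]
  exact ⟨h3, h4⟩

theorem weightAt_init (hu : IsLowest h u) {H : HeightFunction} (hH : H = h ∨ H = raise hu)
    {q : LatticePoint} (hq : H q.i q.j = q.n) :
    weightAt u q = weight u (faceExp (q.i, q.j)) := by
  classical
  rw [weight_faceExp, weightAt]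
  split_ifs with hij
  · obtain ⟨h1, h2⟩ := hij
    rw [h1, h2] at hq ⊢
    rw [sub_self, sub_self]
    rcases hH with rfl | rfl
    · rw [hu.center] at hq
      simp [← hq, coneInd, pointInd]
    · rw [raise_center] at hq
      simp [← hq, coneInd, pointInd]
  · have h0 : H q.i q.j = h q.i q.j := by
      rcases hH with rfl | rfl
      exacts [rfl, raise_apply hu hij]
    have h1 := hu.le_dist_sub_two q.i q.j
    rw [coneInd_eq_zero (by omega), pointInd, if_neg (by omega), add_zero]

/-- Because the two tropical terms are equal, the negated solution solves the negated recurrence: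
maximal and minimal weight coincide. -/
theorem hasFractionDeg_weight (hu : IsLowest h u) {H : HeightFunction}
    (hH : H = h ∨ H = raise hu) {q : LatticePoint} (hq : H q.i q.j ≤ q.n) :
    HasFractionDeg (weight u) (H.g q) (weightAt u q) ∧
      HasFractionDeg (-weight u) (H.g q) (-weightAt u q) := by
  have hlt {q : LatticePoint} (hq : H q.i q.j < q.n) : h q.i q.j < q.n := by
    rcases hH with rfl | rfl
    exacts [hq, (le_raise hu _ _).trans_lt hq]
  constructor
  · refine H.hasFractionDeg_g (fun q hq => weightAt_init hu hH hq) (fun q hq => ?_) q hq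
    obtain ⟨h1, h2⟩ := weightAt_step hu (hlt hq)
    omega
  · refine H.hasFractionDeg_g (D := fun q => -weightAt u q)
      (fun q hq => by rw [weightAt_init hu hH hq, AddMonoidHom.neg_apply]) (fun q hq => ?_) q hq
    obtain ⟨h1, h2⟩ := weightAt_step hu (hlt hq)
    simp only [AddMonoidHom.neg_apply]
    omega

theorem weight_eq (hu : IsLowest h u) {H : HeightFunction} (hH : H = h ∨ H = raise hu)
    {q : LatticePoint} (hq : H q.i q.j ≤ q.n) {F : LaurentRing}
    (hF : algebraMap LaurentRing LaurentField F = H.g q) {m : LaurentExponent}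
    (hm : F.coeff m ≠ 0) : weight u m = weightAt u q := by
  have hd := hasFractionDeg_weight hu hH hq
  rw [← hF] at hd
  have h1 := hd.1.hasMaxDeg.1 m hm
  have h2 := hd.2.hasMaxDeg.1 m hm
  rw [AddMonoidHom.neg_apply] at h2
  omega

/-- Among the values of the recurrence, only the one at `u` has negative degree in the face
variable below `u`. -/
theorem exists_faceDeg_nonneg (hu : IsLowest h u) {q : LatticePoint} (hq : h q.i q.j ≤ q.n)
    (hqu : q ≠ u) {F : LaurentRing}
    (hF : algebraMap LaurentRing LaurentField F = h.g q) :
    ∃ m, F.coeff m ≠ 0 ∧ 0 ≤ faceDeg (u.i, u.j) m := by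
  classical
  have hd := h.hasFractionDeg_g (w := faceDeg (u.i, u.j))
    (D := fun q => coneInd (q.n - u.n - 2) (q.i - u.i) (q.j - u.j) -
      pointInd 0 (q.n - u.n) (q.i - u.i) (q.j - u.j) +
      pointInd (-2) (q.n - u.n) (q.i - u.i) (q.j - u.j)) ?_ ?_ q hq
  · rw [← hF] at hd
    obtain ⟨m, hm, hmd⟩ := hd.hasMaxDeg.2
    refine ⟨m, hm, ?_⟩
    have h1 := coneInd_nonneg (q.n - u.n - 2) (q.i - u.i) (q.j - u.j)
    have h2 : pointInd 0 (q.n - u.n) (q.i - u.i) (q.j - u.j) = 0 := by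
      refine if_neg fun h0 => hqu (LatticePoint.ext ?_ ?_ ?_) <;> omega
    have h3 : 0 ≤ pointInd (-2) (q.n - u.n) (q.i - u.i) (q.j - u.j) := by
      rw [pointInd]
      split_ifs <;> simp
    omega
  · intro q hq
    simp only [faceDeg_faceExp, Prod.mk.injEq]
    have h1 := hu.le_dist_sub_two q.i q.j
    rw [coneInd_eq_zero (by omega)]
    simp only [pointInd]
    have hc : q.i = u.i ∧ q.j = u.j → q.n = u.n - 2 := fun h2 => by
      rw [← hq, h2.1, h2.2, hu.center]
    split_ifs <;> omega
  · intro q hq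
    obtain ⟨h1, h2⟩ := hu.position hq
    have h3 := coneInd_sub_pointInd_step h1 h2
    simp only [LatticePoint.acExp, LatticePoint.bdExp, map_add, faceDeg_edgeExp, add_zero,
      zero_add, LatticePoint.north, LatticePoint.south, LatticePoint.east, LatticePoint.west,
      LatticePoint.below, sub_right_comm _ _ u.n, sub_right_comm _ _ u.i,
      sub_right_comm _ _ u.j, add_sub_right_comm _ _ u.i, add_sub_right_comm _ _ u.j]
    exact h3

end Octahedron

/-! ### The prime binomial at `u` and the substitution x ↦ β/x. -/

namespace Octahedron

open GroupAlgebra AddMonoidAlgebra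

/-- The exponent of `a c x x` in the octahedron relation with top `u`, when the four middle
vertices lie on the initial surface. -/
noncomputable def acTerm (u : LatticePoint) : LaurentExponent :=
  u.acExp + faceExp (u.i, u.j + 1) + faceExp (u.i, u.j - 1)

/-- The exponent of `b d x x` in the octahedron relation with top `u`, when the four middle
vertices lie on the initial surface. -/
noncomputable def bdTerm (u : LatticePoint) : LaurentExponent :=
  u.bdExp + faceExp (u.i + 1, u.j) + faceExp (u.i - 1, u.j)

/-- The binomial on the right-hand side of the octahedron relation with top `u`. -/
noncomputable def binomial (u : LatticePoint) : LaurentRing := mon (acTerm u) + mon (bdTerm u)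

/-- The degree in the face variable below `u`. -/
noncomputable abbrev centerDeg (u : LatticePoint) : LaurentExponent →+ ℤ := faceDeg (u.i, u.j)

/-- The exponent of the face variable below `u`. -/
noncomputable abbrev center (u : LatticePoint) : LaurentExponent := faceExp (u.i, u.j)

theorem centerDeg_center (u : LatticePoint) : centerDeg u (center u) = 1 := by
  classical
  simp [faceDeg_faceExp]

theorem centerDeg_acTerm (u : LatticePoint) : centerDeg u (acTerm u) = 0 := by
  classical
  simp [acTerm, LatticePoint.acExp, faceDeg_faceExp, faceDeg_edgeExp]

theorem centerDeg_bdTerm (u : LatticePoint) : centerDeg u (bdTerm u) = 0 := by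
  classical
  simp [bdTerm, LatticePoint.bdExp, faceDeg_faceExp, faceDeg_edgeExp]

theorem edgeDeg_acTerm (u : LatticePoint) :
    edgeDeg u.edgeA (acTerm u) = 1 ∧ edgeDeg u.edgeB (acTerm u) = 0 ∧
      edgeDeg u.edgeC (acTerm u) = 1 ∧ edgeDeg u.edgeD (acTerm u) = 0 := by
  classical
  simp [acTerm, LatticePoint.acExp, edgeDeg_faceExp, edgeDeg_edgeExp, LatticePoint.edgeA,
    LatticePoint.edgeB, LatticePoint.edgeC, LatticePoint.edgeD]

theorem edgeDeg_bdTerm (u : LatticePoint) :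
    edgeDeg u.edgeA (bdTerm u) = 0 ∧ edgeDeg u.edgeB (bdTerm u) = 1 ∧
      edgeDeg u.edgeC (bdTerm u) = 0 ∧ edgeDeg u.edgeD (bdTerm u) = 1 := by
  classical
  simp [bdTerm, LatticePoint.bdExp, edgeDeg_faceExp, edgeDeg_edgeExp, LatticePoint.edgeA,
    LatticePoint.edgeB, LatticePoint.edgeC, LatticePoint.edgeD]

theorem weight_apply (u : LatticePoint) (m : LaurentExponent) :
    weight u m = centerDeg u m + edgeDeg u.edgeA m + edgeDeg u.edgeB m + edgeDeg u.edgeC m +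
      edgeDeg u.edgeD m := rfl

theorem prime_binomial (u : LatticePoint) : Prime (binomial u) := by
  refine prime_mon_add_mon (edgeDeg u.edgeB) ?_
  rw [map_sub, (edgeDeg_bdTerm u).2.1, (edgeDeg_acTerm u).2.1, sub_zero]

theorem binomial_ne_zero (u : LatticePoint) : binomial u ≠ 0 := (prime_binomial u).ne_zero

theorem coeff_binomial_mul (u : LatticePoint) (P : LaurentRing) (m : LaurentExponent) :
    (binomial u * P).coeff m = P.coeff (m - acTerm u) + P.coeff (m - bdTerm u) := by
  rw [binomial, add_mul, coeff_add, Finsupp.add_apply, coeff_mon_mul, coeff_mon_mul]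

theorem centerDeg_of_coeff_binomial (u : LatticePoint) {m : LaurentExponent}
    (hm : (binomial u).coeff m ≠ 0) : centerDeg u m = 0 := by
  rw [← mul_one (binomial u), coeff_binomial_mul] at hm
  by_cases h1 : (1 : LaurentRing).coeff (m - acTerm u) = 0
  · rw [h1, zero_add, ← mon_zero] at hm
    have := eq_of_coeff_mon_ne_zero hm
    rw [← sub_add_cancel m (bdTerm u), ← this, zero_add, centerDeg_bdTerm]
  · rw [← mon_zero] at h1
    have := eq_of_coeff_mon_ne_zero h1
    rw [← sub_add_cancel m (acTerm u), ← this, zero_add, centerDeg_acTerm]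

variable {h : HeightFunction} {u : LatticePoint}

/-- A multiple of β contains extreme monomials divisible by a c and by b d. In degree at least 0 in
x, weight at most 1 and nonnegative edge degrees leave no room for both. Such a degree does occur
when q ≠ u, by `exists_faceDeg_nonneg`. -/
theorem not_binomial_dvd (hu : IsLowest h u) {q : LatticePoint} (hq : h q.i q.j ≤ q.n)
    (hqu : q ≠ u) {F : LaurentRing} (hF : algebraMap LaurentRing LaurentField F = h.g q) :
    ¬ binomial u ∣ F := by
  classical
  rintro ⟨Z, hZ⟩
  obtain ⟨m, hm, hm0⟩ := exists_faceDeg_nonneg hu hq hqu hF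
  have hA := edgeDeg_acTerm u
  have hB := edgeDeg_bdTerm u
  have cA := centerDeg_acTerm u
  have cB := centerDeg_bdTerm u
  have bound (n : LaurentExponent) (hn : F.coeff n ≠ 0) : weight u n ≤ 1 ∧
      0 ≤ edgeDeg u.edgeA n ∧ 0 ≤ edgeDeg u.edgeB n ∧ 0 ≤ edgeDeg u.edgeC n ∧
      0 ≤ edgeDeg u.edgeD n :=
    ⟨(weight_eq hu (Or.inl rfl) hq hF hn).le.trans (weightAt_le_one u q),
      h.edgeDeg_nonneg hq hF _ hn, h.edgeDeg_nonneg hq hF _ hn, h.edgeDeg_nonneg hq hF _ hn,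
      h.edgeDeg_nonneg hq hF _ hn⟩
  -- The grading μ is 2 on `acTerm u` and -2 on `bdTerm u`, so a cofactor monomial extremal for μ
  -- yields a product monomial that cannot cancel.
  let μ : LaurentExponent →+ ℤ :=
    edgeDeg u.edgeA + edgeDeg u.edgeC - edgeDeg u.edgeB - edgeDeg u.edgeD
  have hμ (n : LaurentExponent) : μ n =
    edgeDeg u.edgeA n + edgeDeg u.edgeC n - edgeDeg u.edgeB n - edgeDeg u.edgeD n := rfl
  -- Since β has degree 0 in x, the monomials of nonnegative degree in x can be treated separately.
  let S := Z.coeff.support.filter (fun n => 0 ≤ centerDeg u n)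
  have memS (n : LaurentExponent) : n ∈ S ↔ Z.coeff n ≠ 0 ∧ 0 ≤ centerDeg u n := by
    simp [S]
  have hS : S.Nonempty := by
    obtain ⟨n, hn, hZn⟩ := exists_of_coeff_mul_ne_zero (hZ ▸ hm)
    refine ⟨m - n, (memS _).2 ⟨hZn, ?_⟩⟩
    rw [map_sub, centerDeg_of_coeff_binomial u hn, sub_zero]
    exact hm0
  obtain ⟨z, hz, hmax⟩ := S.exists_max_image μ hS
  obtain ⟨z', hz', hmin⟩ := S.exists_min_image μ hS
  have h1 : F.coeff (z + acTerm u) ≠ 0 := by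
    rw [hZ, coeff_binomial_mul, add_sub_cancel_right]
    have : Z.coeff (z + acTerm u - bdTerm u) = 0 := by
      by_contra hne
      have hmem : z + acTerm u - bdTerm u ∈ S := by
        refine (memS _).2 ⟨hne, ?_⟩
        rw [map_sub, map_add, cA, cB]
        simpa using ((memS z).1 hz).2
      have := hmax _ hmem
      simp only [hμ, map_add, map_sub] at this
      omega
    rw [this, add_zero]
    exact ((memS z).1 hz).1
  have h2 : F.coeff (z' + bdTerm u) ≠ 0 := by
    rw [hZ, coeff_binomial_mul, add_sub_cancel_right]
    have : Z.coeff (z' + bdTerm u - acTerm u) = 0 := by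
      by_contra hne
      have hmem : z' + bdTerm u - acTerm u ∈ S := by
        refine (memS _).2 ⟨hne, ?_⟩
        rw [map_sub, map_add, cA, cB]
        simpa using ((memS z').1 hz').2
      have := hmin _ hmem
      simp only [hμ, map_add, map_sub] at this
      omega
    rw [this, zero_add]
    exact ((memS z').1 hz').1
  -- The bounds at `z + acTerm u` force μ z ≤ -1, those at `z' + bdTerm u` force μ z' ≥ 1, contrary
  -- to the maximality of z.
  have h3 := hmax z' hz'
  have h4 := ((memS z).1 hz).2
  have h5 := ((memS z').1 hz').2
  have h6 := bound _ h1
  have h7 := bound _ h2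
  simp only [hμ, weight_apply, map_add] at h3 h6 h7
  omega

/-- The ratio by which the substitution `flipHom u` multiplies the face variable below `u`. -/
noncomputable def flipRatio (u : LatticePoint) : LaurentField :=
  algebraMap LaurentRing LaurentField (binomial u * mon (-(2 : ℤ) • center u))

theorem flipRatio_ne_zero (u : LatticePoint) : flipRatio u ≠ 0 :=
  (map_ne_zero_iff _ algebraMap_injective).2 (mul_ne_zero (binomial_ne_zero u) (mon_ne_zero _))

/-- The substitution that replaces the face variable `x` below `u` by the quotient of
`binomial u` by `x`. -/
noncomputable def flipHom (u : LatticePoint) : LaurentRing →ₐ[ℤ] LaurentField :=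
  AddMonoidAlgebra.lift ℤ _ LaurentExponent
    { toFun := fun m => algebraMap LaurentRing LaurentField (mon m.toAdd) *
        flipRatio u ^ centerDeg u m.toAdd
      map_one' := by simp [mon_zero]
      map_mul' := fun m n => by
        rw [toAdd_mul, mon_add, map_mul, map_add, zpow_add₀ (flipRatio_ne_zero u)]
        ring }

theorem flipHom_mon (u : LatticePoint) (m : LaurentExponent) : flipHom u (mon m) =
    algebraMap LaurentRing LaurentField (mon m) * flipRatio u ^ centerDeg u m := by
  simp [flipHom, mon]

theorem flipHom_mon_of_centerDeg {m : LaurentExponent} (hm : centerDeg u m = 0) :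
    flipHom u (mon m) = algebraMap LaurentRing LaurentField (mon m) := by
  rw [flipHom_mon, hm, zpow_zero, mul_one]

theorem algebraMap_mon_mul_neg (m : LaurentExponent) :
    algebraMap LaurentRing LaurentField (mon m) * algebraMap LaurentRing LaurentField (mon (-m)) =
      1 := by
  rw [← map_mul, ← mon_add, add_neg_cancel, mon_zero, map_one]

theorem flipHom_center (u : LatticePoint) : flipHom u (mon (center u)) =
    algebraMap LaurentRing LaurentField (binomial u * mon (-center u)) := by
  rw [flipHom_mon, centerDeg_center, zpow_one, flipRatio, ← map_mul]
  congr 1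
  rw [mul_left_comm, ← mon_add]
  congr 2
  rw [neg_smul, two_smul]
  abel

/-- A monomial of degree k in x is multiplied by (β/x²)^k under the substitution. So degrees k and
-k are exchanged, and after clearing denominators with β^N the power β^(N + k) remains. -/
theorem exists_flip (u : LatticePoint) (F : LaurentRing) : ∃ N₀ : ℕ, ∀ N : ℕ, N₀ ≤ N →
    ∃ X : LaurentRing, algebraMap LaurentRing LaurentField X =
        algebraMap LaurentRing LaurentField (binomial u) ^ N * flipHom u F ∧
      ∀ (k : ℤ) (M : ℕ), (M : ℤ) = N + k → component (centerDeg u) (-k) X =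
        binomial u ^ M * (mon (-(2 * k) • center u) * component (centerDeg u) k F) := by
  induction F using AddMonoidAlgebra.induction_linear with
  | zero =>
    refine ⟨0, fun N _ => ⟨0, by simp, fun k M _ => ?_⟩⟩
    have (k : ℤ) : component (centerDeg u) k (0 : LaurentRing) = 0 :=
      coeff_injective (Finsupp.ext fun m => by simp [coeff_component])
    rw [this, this, mul_zero, mul_zero]
  | add P Q hP hQ =>
    obtain ⟨N₁, h1⟩ := hP
    obtain ⟨N₂, h2⟩ := hQ
    refine ⟨max N₁ N₂, fun N hN => ?_⟩
    obtain ⟨X, hX, hX'⟩ := h1 N (le_of_max_le_left hN)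
    obtain ⟨Y, hY, hY'⟩ := h2 N (le_of_max_le_right hN)
    refine ⟨X + Y, by rw [map_add, hX, hY, map_add, mul_add], fun k M hM => ?_⟩
    rw [component_add, component_add, hX' k M hM, hY' k M hM]
    ring
  | single m r =>
    -- This bound keeps N + `centerDeg u m` nonnegative even when the degree is negative.
    refine ⟨(centerDeg u m).natAbs, fun N hN => ?_⟩
    obtain ⟨T, hT⟩ : ∃ T : ℕ, (T : ℤ) = N + centerDeg u m :=
      ⟨(N + centerDeg u m).toNat, Int.toNat_of_nonneg (by omega)⟩
    have hsingle (n : LaurentExponent) : (single n r : LaurentRing) = r • mon n := by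
      simp [mon, smul_single]
    have hcomp (k : ℤ) (n : LaurentExponent) : component (centerDeg u) k (single n r) =
        if centerDeg u n = k then single n r else 0 := by
      refine coeff_injective (Finsupp.ext fun l => ?_)
      rw [coeff_component]
      by_cases hl : n = l
      · subst hl
        split_ifs <;> simp
      · split_ifs <;> simp [hl]
    have hpow (M : ℕ) (l : LaurentExponent) (hl : (binomial u ^ M).coeff l ≠ 0) :
        centerDeg u l = 0 := by
      induction M generalizing l with
      | zero =>
        rw [pow_zero, ← mon_zero] at hl
        rw [← eq_of_coeff_mon_ne_zero hl, map_zero]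
      | succ M ih =>
        rw [pow_succ] at hl
        obtain ⟨n, h1, h2⟩ := exists_of_coeff_mul_ne_zero hl
        have h3 := ih n h1
        have h4 := centerDeg_of_coeff_binomial u h2
        rw [map_sub] at h4
        omega
    refine ⟨binomial u ^ T * single (m - (2 * centerDeg u m) • center u) r, ?_, ?_⟩
    · have hs : algebraMap LaurentRing LaurentField (binomial u) ≠ 0 :=
        (map_ne_zero_iff _ algebraMap_injective).2 (binomial_ne_zero u)
      have hz : (algebraMap LaurentRing LaurentField (mon (-(2 : ℤ) • center u))) ^
          centerDeg u m = algebraMap LaurentRing LaurentField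
            (mon (-((2 * centerDeg u m) • center u))) := by
        have hnat (k : ℕ) (n : LaurentExponent) : algebraMap LaurentRing LaurentField
            (mon n) ^ k = algebraMap LaurentRing LaurentField (mon (k • n)) := by
          rw [mon_nsmul, map_pow]
        obtain ⟨k, hk | hk⟩ := (centerDeg u m).eq_nat_or_neg
        · rw [hk, zpow_natCast, hnat, ← natCast_zsmul, smul_smul, ← neg_smul]
          congr 3
          ring
        · rw [hk, zpow_neg, zpow_natCast, hnat]
          refine (eq_inv_of_mul_eq_one_right ?_).symm
          rw [← natCast_zsmul, smul_smul, ← neg_smul]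
          convert algebraMap_mon_mul_neg (((k : ℤ) * -2) • center u) using 5
          rw [← neg_smul]
          congr 1
          ring
      rw [hsingle, hsingle, map_zsmul (flipHom u), flipHom_mon, flipRatio,
        map_mul _ (binomial u) (mon _), mul_zpow, hz, map_mul, map_pow, sub_eq_add_neg, map_zsmul,
        mon_add, map_mul, ← zpow_natCast _ T, hT, zpow_add₀ hs, zpow_natCast]
      simp only [mul_smul_comm]
      congr 1
      ring
    · intro k M hM
      rw [← zero_add (-k), component_mul_of_homogeneous (hpow T), hcomp, hcomp]
      rw [map_sub, map_zsmul, centerDeg_center]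
      by_cases hk : centerDeg u m = k
      · have hMT : M = T := by omega
        rw [if_pos (by simp; omega), if_pos hk, hMT, hk, hsingle, hsingle, mul_smul_comm,
          mul_smul_comm, mul_smul_comm, ← mon_add, neg_smul, neg_add_eq_sub]
      · rw [if_neg (by simp; omega), if_neg hk, mul_zero, mul_zero, mul_zero]

end Octahedron

/-! ### The Laurent phenomenon. -/

namespace Octahedron

open GroupAlgebra AddMonoidAlgebra

variable {h : HeightFunction} {u : LatticePoint}

theorem IsLowest.lt (hu : IsLowest h u) : h u.i u.j < u.n := by
  rw [hu.center]
  omega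

theorem g_top_middle (hu : IsLowest h u) :
    h.g u.north = algebraMap LaurentRing LaurentField (mon (faceExp (u.i, u.j + 1))) ∧
    h.g u.south = algebraMap LaurentRing LaurentField (mon (faceExp (u.i, u.j - 1))) ∧
    h.g u.east = algebraMap LaurentRing LaurentField (mon (faceExp (u.i + 1, u.j))) ∧
    h.g u.west = algebraMap LaurentRing LaurentField (mon (faceExp (u.i - 1, u.j))) ∧
    h.g u.below = algebraMap LaurentRing LaurentField (mon (center u)) :=
  ⟨h.g_of_not_lt hu.north.not_lt, h.g_of_not_lt hu.south.not_lt, h.g_of_not_lt hu.east.not_lt,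
    h.g_of_not_lt hu.west.not_lt, h.g_of_not_lt hu.center.not_lt⟩

theorem g_top (hu : IsLowest h u) :
    h.g u = algebraMap LaurentRing LaurentField (binomial u * mon (-center u)) := by
  have h1 := h.g_mul_g_below hu.lt
  obtain ⟨hN, hS, hE, hW, hB⟩ := g_top_middle hu
  rw [hN, hS, hE, hW, hB] at h1
  have h2 : h.g u * algebraMap LaurentRing LaurentField (mon (center u)) =
      algebraMap LaurentRing LaurentField (binomial u) := by
    rw [h1, binomial, acTerm, bdTerm]
    simp only [mon_add, map_add, map_mul]
  rw [map_mul, ← h2, mul_assoc, algebraMap_mon_mul_neg, mul_one]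

/-- Above the raised surface both sides obey the same recurrence. On it they agree: the only changed
initial value is x at `u`, which the substitution turns into β/x. Laurentness is assumed because
`flipHom` is defined on `LaurentRing` only. -/
theorem flipHom_g (hu : IsLowest h u) {p : LatticePoint}
    (hL : ∀ r, InCone p r → ∃ F, algebraMap LaurentRing LaurentField F = (raise hu).g r)
    {r : LatticePoint} (hpr : InCone p r) (hr : raise hu r.i r.j ≤ r.n) {F : LaurentRing}
    (hF : algebraMap LaurentRing LaurentField F = (raise hu).g r) : flipHom u F = h.g r := by
  classical
  refine (raise hu).octahedron_induction (motive := fun r => InCone p r → ∀ F : LaurentRing,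
    algebraMap LaurentRing LaurentField F = (raise hu).g r → flipHom u F = h.g r)
    (fun r h0 _ F hF => ?_) (fun r h0 hN hS hE hW hB hpr F hF => ?_) r hr hpr F hF
  · rw [(raise hu).g_of_not_lt h0.not_lt] at hF
    rw [algebraMap_injective hF]
    by_cases hij : r.i = u.i ∧ r.j = u.j
    · have : r = u := by
        refine LatticePoint.ext ?_ hij.1 hij.2
        rw [← h0, hij.1, hij.2, raise_center]
      rw [this, flipHom_center, g_top hu]
    · rw [raise_apply hu hij] at h0
      rw [h.g_of_not_lt h0.not_lt, flipHom_mon_of_centerDeg]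
      simp [faceDeg_faceExp, hij]
  · have iN := hpr.trans (inCone_north r)
    have iS := hpr.trans (inCone_south r)
    have iE := hpr.trans (inCone_east r)
    have iW := hpr.trans (inCone_west r)
    have iB := hpr.trans (inCone_below r)
    obtain ⟨FN, hFN⟩ := hL _ iN
    obtain ⟨FS, hFS⟩ := hL _ iS
    obtain ⟨FE, hFE⟩ := hL _ iE
    obtain ⟨FW, hFW⟩ := hL _ iW
    obtain ⟨FB, hFB⟩ := hL _ iB
    have h1 := (raise hu).g_mul_g_below h0
    rw [← hF, ← hFN, ← hFS, ← hFE, ← hFW, ← hFB] at h1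
    simp only [← map_mul, ← map_add] at h1
    have h2 := congrArg (flipHom u) (algebraMap_injective h1)
    have hac : centerDeg u r.acExp = 0 := by
      simp [LatticePoint.acExp, faceDeg_edgeExp]
    have hbd : centerDeg u r.bdExp = 0 := by
      simp [LatticePoint.bdExp, faceDeg_edgeExp]
    simp only [map_mul, map_add, flipHom_mon_of_centerDeg hac, flipHom_mon_of_centerDeg hbd] at h2
    rw [hN iN FN hFN, hS iS FS hFS, hE iE FE hFE, hW iW FW hFW, hB iB FB hFB,
      ← h.g_mul_g_below ((le_raise hu _ _).trans_lt h0)] at h2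
    exact mul_right_cancel₀ (h.g_ne_zero _) h2

/-- Each of the four middle values has one term containing f. In the numerator only two products
avoid f; the edge relations give them the common factor ac·bd·F₁F₂F₃F₄. What remains of them is the
relation for f over xN·xS·xE·xW, namely x₀·f over that product. -/
theorem double_octahedron_identity {k : Type*} [Field k]
    {x₀ xN xS xE xW iN iS iE iW f gN gS gE gW ac bd ac₀ bd₀ acN bdN acS bdS acE bdE acW bdW
      F₁ F₂ F₃ F₄ GN GS GE GW : k}
    (hN : xN * iN = 1) (hS : xS * iS = 1) (hE : xE * iE = 1) (hW : xW * iW = 1)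
    (rN : gN * xN = acN * GN * f + bdN * F₁ * F₂) (rS : gS * xS = acS * f * GS + bdS * F₃ * F₄)
    (rE : gE * xE = acE * F₁ * F₃ + bdE * GE * f) (rW : gW * xW = acW * F₂ * F₄ + bdW * f * GW)
    (hbd : bdN * bdS = bd * bd₀) (hac : acE * acW = ac * ac₀)
    (hf : x₀ * f = ac₀ * xN * xS + bd₀ * xE * xW) :
    ac * gN * gS + bd * gE * gW =
      (ac * iN * iS * (acN * GN * (acS * GS) * f + acN * GN * (bdS * F₃ * F₄) +
          bdN * F₁ * F₂ * (acS * GS)) +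
        bd * iE * iW * (bdE * GE * (bdW * GW) * f + bdE * GE * (acW * F₂ * F₄) +
          acE * F₁ * F₃ * (bdW * GW)) +
        ac * bd * x₀ * iN * iS * iE * iW * F₁ * F₂ * F₃ * F₄) * f := by
  have eN : gN = iN * (acN * GN * f + bdN * F₁ * F₂) := by
    rw [← rN, mul_comm gN, ← mul_assoc, mul_comm iN, hN, one_mul]
  have eS : gS = iS * (acS * f * GS + bdS * F₃ * F₄) := by
    rw [← rS, mul_comm gS, ← mul_assoc, mul_comm iS, hS, one_mul]
  have eE : gE = iE * (acE * F₁ * F₃ + bdE * GE * f) := by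
    rw [← rE, mul_comm gE, ← mul_assoc, mul_comm iE, hE, one_mul]
  have eW : gW = iW * (acW * F₂ * F₄ + bdW * f * GW) := by
    rw [← rW, mul_comm gW, ← mul_assoc, mul_comm iW, hW, one_mul]
  rw [eN, eS, eE, eW]
  linear_combination (ac * iN * iS * (F₁ * F₂ * F₃ * F₄)) * hbd +
    (bd * iE * iW * (F₁ * F₂ * F₃ * F₄)) * hac -
    (ac * bd * iN * iS * iE * iW * (F₁ * F₂ * F₃ * F₄)) * hf -
    (ac * bd * (F₁ * F₂ * F₃ * F₄) * ac₀ * iE * iW) * (xS * iS * hN + hS) -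
    (ac * bd * (F₁ * F₂ * F₃ * F₄) * bd₀ * iN * iS) * (xW * iW * hE + hW)

/-- The divisibility argument fails here, the divisor β/x being β up to a unit. The quotient is
instead written down explicitly. -/
theorem exists_laurent_above (hu : IsLowest h u) {q : LatticePoint} (hq : q.below = u)
    (hL : ∀ r, InCone q r → r ≠ q → ∃ F, algebraMap LaurentRing LaurentField F = h.g r) :
    ∃ F, algebraMap LaurentRing LaurentField F = h.g q := by
  have hn : q.n - 2 = u.n := congrArg LatticePoint.n hq
  have hi : q.i = u.i := by rw [← hq]; rfl
  have hj : q.j = u.j := by rw [← hq]; rfl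
  have c0 := hu.center
  have cN := hu.north
  have cS := hu.south
  have cE := hu.east
  have cW := hu.west
  rw [← hi, ← hj] at c0 cN cS cE cW
  have r0 := h.g_mul_g_below (p := q) (by omega)
  have rN := h.g_mul_g_below (p := q.north) (by simp only [LatticePoint.north]; omega)
  have rS := h.g_mul_g_below (p := q.south) (by simp only [LatticePoint.south]; omega)
  have rE := h.g_mul_g_below (p := q.east) (by simp only [LatticePoint.east]; omega)
  have rW := h.g_mul_g_below (p := q.west) (by simp only [LatticePoint.west]; omega)
  have ext' {r s : LatticePoint} (h1 : r.n = s.n) (h2 : r.i = s.i) (h3 : r.j = s.j) : r = s :=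
    LatticePoint.ext h1 h2 h3
  have eN : q.north.below = u.north := by
    apply ext' <;> simp only [LatticePoint.north, LatticePoint.below] <;> omega
  have eS : q.south.below = u.south := by
    apply ext' <;> simp only [LatticePoint.south, LatticePoint.below] <;> omega
  have eE : q.east.below = u.east := by
    apply ext' <;> simp only [LatticePoint.east, LatticePoint.below] <;> omega
  have eW : q.west.below = u.west := by
    apply ext' <;> simp only [LatticePoint.west, LatticePoint.below] <;> omega
  have eNS : q.north.south = u := by
    apply ext' <;> simp only [LatticePoint.north, LatticePoint.south] <;> omega
  have eSN : q.south.north = u := by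
    apply ext' <;> simp only [LatticePoint.north, LatticePoint.south] <;> omega
  have eEW : q.east.west = u := by
    apply ext' <;> simp only [LatticePoint.east, LatticePoint.west] <;> omega
  have eWE : q.west.east = u := by
    apply ext' <;> simp only [LatticePoint.east, LatticePoint.west] <;> omega
  have eEN : q.east.north = q.north.east := rfl
  have eES : q.east.south = q.south.east := rfl
  have eWN : q.west.north = q.north.west := rfl
  have eWS : q.west.south = q.south.west := rfl
  obtain ⟨mN, mS, mE, mW, -⟩ := g_top_middle hu
  have hbd : q.north.bdExp + q.south.bdExp = q.bdExp + u.bdExp := by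
    have e1 : q.north.edgeB = q.edgeB := by
      ext <;> simp [LatticePoint.north, LatticePoint.edgeB]
    have e2 : q.south.edgeB = u.edgeB := by
      ext <;> simp [LatticePoint.south, LatticePoint.edgeB] <;> omega
    have e3 : q.north.edgeD = u.edgeD := by
      ext <;> simp [LatticePoint.north, LatticePoint.edgeD] <;> omega
    have e4 : q.south.edgeD = q.edgeD := by
      ext <;> simp [LatticePoint.south, LatticePoint.edgeD]
    rw [LatticePoint.bdExp, LatticePoint.bdExp, LatticePoint.bdExp, LatticePoint.bdExp,
      e1, e2, e3, e4]
    abel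
  have hac : q.east.acExp + q.west.acExp = q.acExp + u.acExp := by
    have e1 : q.east.edgeA = q.edgeA := by
      ext <;> simp [LatticePoint.east, LatticePoint.edgeA]
    have e2 : q.west.edgeA = u.edgeA := by
      ext <;> simp [LatticePoint.west, LatticePoint.edgeA] <;> omega
    have e3 : q.east.edgeC = u.edgeC := by
      ext <;> simp [LatticePoint.east, LatticePoint.edgeC] <;> omega
    have e4 : q.west.edgeC = q.edgeC := by
      ext <;> simp [LatticePoint.west, LatticePoint.edgeC]
    rw [LatticePoint.acExp, LatticePoint.acExp, LatticePoint.acExp, LatticePoint.acExp,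
      e1, e2, e3, e4]
    abel
  have hbd' := congrArg (fun m => algebraMap LaurentRing LaurentField (mon m)) hbd
  have hac' := congrArg (fun m => algebraMap LaurentRing LaurentField (mon m)) hac
  have hu' := g_top hu
  have hu0 := h.g_ne_zero u
  rw [eN, eNS, mN] at rN
  rw [eS, eSN, mS] at rS
  rw [eE, eEW, mE, eEN, eES] at rE
  rw [eW, eWE, mW, eWN, eWS] at rW
  rw [hq] at r0
  have hC := algebraMap_mon_mul_neg (center u)
  have hN := algebraMap_mon_mul_neg (faceExp (u.i, u.j + 1))
  have hS := algebraMap_mon_mul_neg (faceExp (u.i, u.j - 1))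
  have hE := algebraMap_mon_mul_neg (faceExp (u.i + 1, u.j))
  have hW := algebraMap_mon_mul_neg (faceExp (u.i - 1, u.j))
  have hne {r : LatticePoint} (hr : r.n < q.n) : r ≠ q := fun h0 => hr.ne (congrArg _ h0)
  obtain ⟨F1, h1⟩ := hL _ ((inCone_north q).trans (inCone_east _))
    (hne (by simp only [LatticePoint.north, LatticePoint.east]; omega))
  obtain ⟨F2, h2⟩ := hL _ ((inCone_north q).trans (inCone_west _))
    (hne (by simp only [LatticePoint.north, LatticePoint.west]; omega))
  obtain ⟨F3, h3⟩ := hL _ ((inCone_south q).trans (inCone_east _))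
    (hne (by simp only [LatticePoint.south, LatticePoint.east]; omega))
  obtain ⟨F4, h4⟩ := hL _ ((inCone_south q).trans (inCone_west _))
    (hne (by simp only [LatticePoint.south, LatticePoint.west]; omega))
  obtain ⟨GN, gN⟩ := hL _ ((inCone_north q).trans (inCone_north _))
    (hne (by simp only [LatticePoint.north]; omega))
  obtain ⟨GS, gS⟩ := hL _ ((inCone_south q).trans (inCone_south _))
    (hne (by simp only [LatticePoint.south]; omega))
  obtain ⟨GE, gE⟩ := hL _ ((inCone_east q).trans (inCone_east _))
    (hne (by simp only [LatticePoint.east]; omega))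
  obtain ⟨GW, gW⟩ := hL _ ((inCone_west q).trans (inCone_west _))
    (hne (by simp only [LatticePoint.west]; omega))
  rw [← h1, ← h2, ← gN] at rN
  rw [← h3, ← h4, ← gS] at rS
  rw [← h1, ← h3, ← gE] at rE
  rw [← h2, ← h4, ← gW] at rW
  refine ⟨mon q.acExp * mon (-faceExp (u.i, u.j + 1)) * mon (-faceExp (u.i, u.j - 1)) *
      (mon q.north.acExp * GN * (mon q.south.acExp * GS) * (binomial u * mon (-center u)) +
        mon q.north.acExp * GN * (mon q.south.bdExp * F3 * F4) +
        mon q.north.bdExp * F1 * F2 * (mon q.south.acExp * GS)) +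
    mon q.bdExp * mon (-faceExp (u.i + 1, u.j)) * mon (-faceExp (u.i - 1, u.j)) *
      (mon q.east.bdExp * GE * (mon q.west.bdExp * GW) * (binomial u * mon (-center u)) +
        mon q.east.bdExp * GE * (mon q.west.acExp * F2 * F4) +
        mon q.east.acExp * F1 * F3 * (mon q.west.bdExp * GW)) +
    mon q.acExp * mon q.bdExp * mon (center u) * mon (-faceExp (u.i, u.j + 1)) *
      mon (-faceExp (u.i, u.j - 1)) * mon (-faceExp (u.i + 1, u.j)) *
      mon (-faceExp (u.i - 1, u.j)) * F1 * F2 * F3 * F4, ?_⟩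
  refine mul_right_cancel₀ hu0 ?_
  rw [r0]
  simp only [mon_add, map_mul] at hac' hbd'
  have hf : algebraMap LaurentRing LaurentField (mon (center u)) * h.g u =
      algebraMap LaurentRing LaurentField (mon u.acExp) *
        algebraMap LaurentRing LaurentField (mon (faceExp (u.i, u.j + 1))) *
        algebraMap LaurentRing LaurentField (mon (faceExp (u.i, u.j - 1))) +
      algebraMap LaurentRing LaurentField (mon u.bdExp) *
        algebraMap LaurentRing LaurentField (mon (faceExp (u.i + 1, u.j))) *
        algebraMap LaurentRing LaurentField (mon (faceExp (u.i - 1, u.j))) := by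
    rw [hu', map_mul, mul_left_comm, hC, mul_one, binomial, acTerm, bdTerm]
    simp only [mon_add, map_add, map_mul]
  simp only [map_add, map_mul _ (binomial u) _, map_mul] at hu' ⊢
  rw [← hu']
  exact (double_octahedron_identity hN hS hE hW rN rS rE rW hbd' hac' hf).symm

theorem exists_laurent (h : HeightFunction) (q : LatticePoint) :
    ∃ F, algebraMap LaurentRing LaurentField F = h.g q := by
  induction hN : (h.coneAbove q).ncard using Nat.strong_induction_on generalizing h q with
  | _ N ih =>
    by_cases hq : h q.i q.j < q.n
    swap
    · exact ⟨_, (h.g_of_not_lt hq).symm⟩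
    have key (r : LatticePoint) (hr : InCone q r) (hne : r ≠ q) :
        ∃ F, algebraMap LaurentRing LaurentField F = h.g r := by
      refine ih _ (hN ▸ h.ncard_coneAbove_lt hq ?_ hr) h r rfl
      by_contra! hc
      rw [InCone] at hr
      have h1 := abs_nonneg (r.i - q.i)
      have h2 := abs_nonneg (r.j - q.j)
      have h3 : r.i - q.i = 0 := abs_eq_zero.1 (by omega)
      have h4 : r.j - q.j = 0 := abs_eq_zero.1 (by omega)
      exact hne (LatticePoint.ext (by omega) (by omega) (by omega))
    obtain ⟨u, hqu, hu⟩ := h.exists_isLowest hq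
    by_cases h0 : q = u
    · exact ⟨_, h0 ▸ (g_top hu).symm⟩
    by_cases h1 : q.below = u
    · exact exists_laurent_above hu h1 key
    have hL (r : LatticePoint) (hr : InCone q r) :
        ∃ F, algebraMap LaurentRing LaurentField F = (raise hu).g r :=
      ih _ (hN ▸ ncard_raise_lt hu hqu hr) (raise hu) r rfl
    obtain ⟨F, hF⟩ := hL q (InCone.refl q)
    have hflip := flipHom_g hu hL (InCone.refl q) (raise_le hu hq hqu) hF
    obtain ⟨n, hn⟩ := exists_flip u F
    obtain ⟨X, hX, -⟩ := hn n le_rfl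
    rw [hflip] at hX
    have hne {r : LatticePoint} (hr : r.n < q.n) : r ≠ q := fun h0 => hr.ne (congrArg _ h0)
    obtain ⟨FN, hFN⟩ := key _ (inCone_north q) (hne (by simp [LatticePoint.north]))
    obtain ⟨FS, hFS⟩ := key _ (inCone_south q) (hne (by simp [LatticePoint.south]))
    obtain ⟨FE, hFE⟩ := key _ (inCone_east q) (hne (by simp [LatticePoint.east]))
    obtain ⟨FW, hFW⟩ := key _ (inCone_west q) (hne (by simp [LatticePoint.west]))
    obtain ⟨G, hG⟩ := key _ (inCone_below q) (hne (by simp [LatticePoint.below]))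
    have hnd := not_binomial_dvd hu (h.le_below hq) h1 hG
    have hrec := h.g_mul_g_below hq
    rw [← hG, ← hFN, ← hFS, ← hFE, ← hFW] at hrec
    have hXG : X * G = binomial u ^ n *
        (mon q.acExp * FN * FS + mon q.bdExp * FE * FW) := by
      refine algebraMap_injective ?_
      rw [map_mul, hX, mul_assoc, hrec]
      simp only [map_mul, map_add, map_pow]
    -- The prime β does not divide G, so the whole power β^n divides X and the denominator
    -- disappears.
    obtain ⟨Y, rfl⟩ := (prime_binomial u).pow_dvd_of_dvd_mul_right n hnd ⟨_, hXG⟩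
    refine ⟨Y, ?_⟩
    rw [map_mul, map_pow] at hX
    exact mul_left_cancel₀ (pow_ne_zero _ ((map_ne_zero_iff _ algebraMap_injective).2
      (binomial_ne_zero u))) hX

end Octahedron

/-! ### Effect of a flip on coefficients. -/

namespace Octahedron

open GroupAlgebra AddMonoidAlgebra

variable {h : HeightFunction} {u : LatticePoint}

theorem coeff_binomial_pow_mul (u : LatticePoint) (k : ℕ) (P : LaurentRing)
    (m : LaurentExponent) : (binomial u ^ k * P).coeff m = ∑ i ∈ Finset.range (k + 1),
      (k.choose i : ℤ) *
        P.coeff (m - (i : ℤ) • acTerm u - ((k : ℤ) - (i : ℤ)) • bdTerm u) := by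
  rw [binomial, add_pow, Finset.sum_mul, coeff_sum, Finsupp.finsetSum_apply]
  refine Finset.sum_congr rfl fun i hi => ?_
  have hi' : i ≤ k := Nat.lt_succ_iff.1 (Finset.mem_range.1 hi)
  rw [← mon_nsmul, ← mon_nsmul, ← mon_add, mul_comm (mon _), mul_assoc, ← nsmul_eq_mul,
    coeff_smul_apply, coeff_mon_mul, nsmul_eq_mul, ← sub_sub, ← natCast_zsmul, ← natCast_zsmul,
    Nat.cast_sub hi']

/-- These are the formulas of `exists_flip` for k and -k with the common power of β cancelled,
arranged to avoid negative powers of β. -/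
theorem component_flip {P P' : LaurentRing}
    (hP : flipHom u P = algebraMap LaurentRing LaurentField P') (k : ℕ) :
    component (centerDeg u) (-k) P' = binomial u ^ k *
        (mon (-(2 * (k : ℤ)) • center u) * component (centerDeg u) k P) ∧
      binomial u ^ k * component (centerDeg u) k P' =
        mon ((2 * (k : ℤ)) • center u) * component (centerDeg u) (-k) P := by
  obtain ⟨N₀, hN₀⟩ := exists_flip u P
  obtain ⟨X, hX, hX'⟩ := hN₀ (N₀ + k) (Nat.le_add_right _ _)
  rw [hP, ← map_pow, ← map_mul] at hX
  rw [algebraMap_injective hX] at hX'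
  have hpow (M : ℕ) (l : LaurentExponent) (hl : (binomial u ^ M).coeff l ≠ 0) :
      centerDeg u l = 0 := by
    rw [← mul_one (binomial u ^ M), coeff_binomial_pow_mul] at hl
    obtain ⟨i, -, hi⟩ := Finset.exists_ne_zero_of_sum_ne_zero hl
    have h1 := congrArg (centerDeg u) (eq_of_coeff_mon_ne_zero (right_ne_zero_of_mul hi))
    rw [map_sub, map_sub, map_zsmul, map_zsmul, centerDeg_acTerm, centerDeg_bdTerm] at h1
    simpa using h1.symm
  have hcomp (l : ℤ) : component (centerDeg u) l (binomial u ^ (N₀ + k) * P') =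
      binomial u ^ (N₀ + k) * component (centerDeg u) l P' := by
    rw [← component_mul_of_homogeneous (hpow (N₀ + k)), zero_add]
  have h0 := fun M : ℕ => pow_ne_zero M (binomial_ne_zero u)
  constructor
  · have h1 := hX' k (N₀ + k + k) (by push_cast; ring)
    rw [hcomp, pow_add _ (N₀ + k), mul_assoc] at h1
    exact mul_left_cancel₀ (h0 _) h1
  · have h1 := hX' (-k) N₀ (by push_cast; ring)
    rw [hcomp, neg_neg, pow_add, mul_assoc] at h1
    rw [mul_left_cancel₀ (h0 _) h1, mul_neg, neg_neg]

/-- The exponent `m` has weight `w`, and nonnegative degree in the four edge variables. -/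
structure Admissible (u : LatticePoint) (w : ℤ) (m : LaurentExponent) : Prop where
  weight_eq : weight u m = w
  edgeA_nonneg : 0 ≤ edgeDeg u.edgeA m
  edgeB_nonneg : 0 ≤ edgeDeg u.edgeB m
  edgeC_nonneg : 0 ≤ edgeDeg u.edgeC m
  edgeD_nonneg : 0 ≤ edgeDeg u.edgeD m

/-- The degree in the central face variable of a monomial of weight `w`, as a function of its
degrees in the edge variables. -/
noncomputable def complDeg (u : LatticePoint) (w : ℤ) (m : LaurentExponent) : ℤ :=
  w - (edgeDeg u.edgeA m + edgeDeg u.edgeB m + edgeDeg u.edgeC m + edgeDeg u.edgeD m)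

theorem Admissible.centerDeg_eq {w : ℤ} {m : LaurentExponent} (hm : Admissible u w m) :
    centerDeg u m = complDeg u w m := by
  have := hm.weight_eq
  rw [weight_apply] at this
  rw [complDeg]
  omega

/-- The shift of exponents by which the coefficients before and after a flip correspond. -/
noncomputable def flipShift (u : LatticePoint) (w : ℤ) (m : LaurentExponent) : LaurentExponent :=
  if 0 ≤ complDeg u w m then complDeg u w m • acTerm u - (2 * complDeg u w m) • center u
  else -(min (edgeDeg u.edgeA m) (edgeDeg u.edgeC m) • acTerm u) -
    (-complDeg u w m - min (edgeDeg u.edgeA m) (edgeDeg u.edgeC m)) • bdTerm u +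
    (2 * -complDeg u w m) • center u

/-- The factor by which the coefficients before and after a flip differ. -/
noncomputable def flipFactor (u : LatticePoint) (w : ℤ) (m : LaurentExponent) : ℕ :=
  if 0 ≤ complDeg u w m then 1
  else (-complDeg u w m).toNat.choose (min (edgeDeg u.edgeA m) (edgeDeg u.edgeC m)).toNat

/-- Coefficients are compared in the identities of `component_flip`; the weight bound kills all
summands of the expanded β^k but one. -/
theorem coeff_flip {w : ℤ} (hw : w ≤ 2) {P P' : LaurentRing}
    (hP : ∀ m, P.coeff m ≠ 0 → Admissible u w m) (hP' : ∀ m, P'.coeff m ≠ 0 → Admissible u w m)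
    (hflip : flipHom u P = algebraMap LaurentRing LaurentField P') {m : LaurentExponent}
    (hm : Admissible u w m) :
    P'.coeff m = flipFactor u w m * P.coeff (m + flipShift u w m) := by
  have hA := edgeDeg_acTerm u
  have hB := edgeDeg_bdTerm u
  have cA := centerDeg_acTerm u
  have cB := centerDeg_bdTerm u
  have cC := centerDeg_center u
  have eC (e : EdgeIndex) : edgeDeg e (center u) = 0 := edgeDeg_faceExp _ _
  have hc := hm.centerDeg_eq
  have hmA := hm.edgeA_nonneg
  have hmB := hm.edgeB_nonneg
  have hmC := hm.edgeC_nonneg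
  have hmD := hm.edgeD_nonneg
  by_cases hk : 0 ≤ complDeg u w m
  · rw [flipShift, flipFactor, if_pos hk, if_pos hk, Nat.cast_one, one_mul]
    obtain ⟨k, hk⟩ := Int.eq_ofNat_of_zero_le hk
    rw [hk] at hc ⊢
    -- At this exponent the summand i = k of the expansion is the coefficient of P' at m.
    have h1 := congrArg (fun F => F.coeff (m + (k : ℤ) • acTerm u)) (component_flip hflip k).2
    rw [coeff_binomial_pow_mul, coeff_mon_mul, coeff_component, if_pos, add_sub_assoc,
      Finset.sum_eq_single k] at h1
    · rw [← h1, Nat.choose_self, Nat.cast_one, one_mul, coeff_component,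
        add_sub_cancel_right, sub_self, zero_smul, sub_zero, if_pos hc]
    · intro i hi hik
      have hik' : (i : ℤ) < k := by
        have := Finset.mem_range.1 hi
        omega
      rw [mul_eq_zero]
      right
      by_contra hne
      rw [coeff_component] at hne
      have hne' : P'.coeff (m + (k : ℤ) • acTerm u - (i : ℤ) • acTerm u -
          ((k : ℤ) - (i : ℤ)) • bdTerm u) ≠ 0 := by
        intro h0
        rw [h0, ite_self] at hne
        exact hne rfl
      obtain ⟨h2, h3, h4, h5, h6⟩ := hP' _ hne'
      -- A surviving summand with i < k would need the b- and d-degrees of m to be at least 1; with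
      -- k ≥ 1 the weight would exceed 2.
      rw [complDeg] at hk
      simp only [weight_apply, map_add, map_sub, map_zsmul, smul_eq_mul, hA, hB, cA, cB,
        mul_one, mul_zero] at h2 h3 h4 h5 h6
      omega
    · intro h2
      exact absurd (Finset.self_mem_range_succ k) h2
    · simp only [map_add, map_sub, map_zsmul, smul_eq_mul, cA, cC, hc]
      ring
  · rw [flipShift, flipFactor, if_neg hk, if_neg hk]
    obtain ⟨k, hk'⟩ := Int.eq_ofNat_of_zero_le (show 0 ≤ -complDeg u w m by omega)
    obtain ⟨i₀, hi₀⟩ := Int.eq_ofNat_of_zero_le (le_min hmA hmC)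
    have hc' : centerDeg u m = -(k : ℤ) := by omega
    have h1 := congrArg (fun F => F.coeff m) (component_flip hflip k).1
    rw [coeff_component, if_pos hc', coeff_binomial_pow_mul] at h1
    have hterm (i : ℕ) : (mon (-(2 * (k : ℤ)) • center u) * component (centerDeg u) k P).coeff
        (m - (i : ℤ) • acTerm u - ((k : ℤ) - (i : ℤ)) • bdTerm u) =
        P.coeff (m + (-((i : ℤ) • acTerm u) - ((k : ℤ) - (i : ℤ)) • bdTerm u +
          (2 * (k : ℤ)) • center u)) := by
      have e : m - (i : ℤ) • acTerm u - ((k : ℤ) - (i : ℤ)) • bdTerm u -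
          -(2 * (k : ℤ)) • center u = m + (-((i : ℤ) • acTerm u) -
          ((k : ℤ) - (i : ℤ)) • bdTerm u + (2 * (k : ℤ)) • center u) := by
        rw [neg_smul]
        abel
      rw [coeff_mon_mul, e, coeff_component, if_pos]
      simp only [map_add, map_sub, map_neg, map_zsmul, smul_eq_mul, cA, cB, cC, hc']
      ring
    rw [h1, hk', hi₀, Int.toNat_natCast, Int.toNat_natCast, ← hterm i₀]
    refine Finset.sum_eq_single i₀ (fun i hi hne => ?_) (fun hi => ?_)
    · rw [mul_eq_zero]
      right
      by_contra h0
      rw [hterm] at h0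
      -- The shifted monomial has degree k ≥ 1 in x, so its edge degrees sum to at most 1. Its a-
      -- and c-degrees cannot both be positive, which pins i to their minimum in m.
      obtain ⟨h2, h3, h4, h5, h6⟩ := hP _ h0
      simp only [weight_apply, map_add, map_sub, map_neg, map_zsmul, smul_eq_mul, hA, hB, cA, cB,
        cC, eC, hc', mul_one, mul_zero] at h2 h3 h4 h5 h6
      omega
    · rw [Nat.choose_eq_zero_of_lt (by rw [Finset.mem_range] at hi; omega), Nat.cast_zero,
        zero_mul]

/-- In the negative case the shifted monomial has total edge degree w - k, so k ≤ w ≤ 2. The nonzero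
binomial coefficients in those rows are 1 and 2. -/
theorem flipFactor_eq {w : ℤ} (hw : w ≤ 2) {m : LaurentExponent}
    (hm : Admissible u w (m + flipShift u w m)) (h0 : flipFactor u w m ≠ 0) :
    flipFactor u w m = 1 ∨ flipFactor u w m = 2 := by
  rw [flipFactor] at *
  split_ifs at h0 ⊢ with hk
  · exact Or.inl rfl
  · have hA := edgeDeg_acTerm u
    have hB := edgeDeg_bdTerm u
    have eC (e : EdgeIndex) : edgeDeg e (center u) = 0 := edgeDeg_faceExp _ _
    obtain ⟨h2, h3, h4, h5, h6⟩ := hm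
    have hk2 : (-complDeg u w m).toNat ≤ 2 := by
      rw [flipShift, if_neg hk] at h3 h4 h5 h6
      simp only [map_add, map_sub, map_neg, map_zsmul, smul_eq_mul, hA, hB, eC, mul_one,
        mul_zero] at h3 h4 h5 h6
      have hd := complDeg.eq_1 u w m
      omega
    generalize (-complDeg u w m).toNat = k at *
    generalize (min (edgeDeg u.edgeA m) (edgeDeg u.edgeC m)).toNat = i at *
    have hi : i ≤ k := by
      by_contra! hc
      exact h0 (Nat.choose_eq_zero_of_lt hc)
    interval_cases k <;> interval_cases i <;> simp

/-- This is why `complDeg` stands in for the degree in x: the shift must not depend on face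
exponents. -/
theorem flipShift_congr (w : ℤ) {m n : LaurentExponent} (hmn : m.2 = n.2) :
    flipShift u w m = flipShift u w n := by
  simp only [flipShift, complDeg, edgeDeg_apply, hmn]
  exact if_congr Iff.rfl rfl rfl

/-- The monomials that appear in `P` or `Q` appear in exactly one of them, have coefficients
powers of two, and are determined by their edge variables. -/
structure StronglySplit (P Q : LaurentRing) : Prop where
  split : MonomialsSplit P Q
  inj : ∀ m n, P.coeff m ≠ 0 ∨ Q.coeff m ≠ 0 → P.coeff n ≠ 0 ∨ Q.coeff n ≠ 0 → m.2 = n.2 → m = n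

/-- Having a common weight, P and Q undergo the same shift and the same factor at each exponent, so
neither disjointness nor powers of two are lost. -/
theorem StronglySplit.flip {w : ℤ} (hw : w ≤ 2) {P P' Q Q' : LaurentRing}
    (hP : ∀ m, P.coeff m ≠ 0 → Admissible u w m) (hP' : ∀ m, P'.coeff m ≠ 0 → Admissible u w m)
    (hQ : ∀ m, Q.coeff m ≠ 0 → Admissible u w m) (hQ' : ∀ m, Q'.coeff m ≠ 0 → Admissible u w m)
    (hPf : flipHom u P = algebraMap LaurentRing LaurentField P')
    (hQf : flipHom u Q = algebraMap LaurentRing LaurentField Q') (hs : StronglySplit P Q) :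
    StronglySplit P' Q' := by
  have key (m : LaurentExponent) (hm : P'.coeff m ≠ 0 ∨ Q'.coeff m ≠ 0) :
      P'.coeff m = flipFactor u w m * P.coeff (m + flipShift u w m) ∧
      Q'.coeff m = flipFactor u w m * Q.coeff (m + flipShift u w m) ∧
      (flipFactor u w m = 1 ∨ flipFactor u w m = 2) ∧
      (P.coeff (m + flipShift u w m) ≠ 0 ∨ Q.coeff (m + flipShift u w m) ≠ 0) := by
    have hadm : Admissible u w m := hm.elim (hP' m) (hQ' m)
    have h1 := coeff_flip hw hP hP' hPf hadm
    have h2 := coeff_flip hw hQ hQ' hQf hadm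
    refine ⟨h1, h2, ?_⟩
    rw [h1, h2] at hm
    rcases hm with hm | hm
    · have h3 := right_ne_zero_of_mul hm
      exact ⟨flipFactor_eq hw (hP _ h3) (by exact_mod_cast left_ne_zero_of_mul hm), Or.inl h3⟩
    · have h3 := right_ne_zero_of_mul hm
      exact ⟨flipFactor_eq hw (hQ _ h3) (by exact_mod_cast left_ne_zero_of_mul hm), Or.inr h3⟩
  refine ⟨fun m hm => ?_, fun m n hm hn hmn => ?_⟩
  · obtain ⟨h1, h2, h3, h4⟩ := key m hm
    obtain ⟨h5, k, h6⟩ := hs.split _ h4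
    rw [coeff_add, Finsupp.add_apply] at h6 ⊢
    rw [h1, h2, ← mul_add, h6]
    rcases h3 with h3 | h3 <;> rw [h3]
    · exact ⟨by simpa only [Nat.cast_one, one_mul] using h5, k, by rw [Nat.cast_one, one_mul]⟩
    · refine ⟨by simpa using h5, k + 1, by rw [pow_succ]; push_cast; ring⟩
  · obtain ⟨-, -, -, h1⟩ := key m hm
    obtain ⟨-, -, -, h2⟩ := key n hn
    have h3 := flipShift_congr (u := u) w hmn
    have := hs.inj _ _ h1 h2 (by rw [h3, Prod.snd_add, Prod.snd_add, hmn])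
    rw [h3] at this
    exact add_right_cancel this

theorem admissible_term (hu : IsLowest h u) {H : HeightFunction} (hH : H = h ∨ H = raise hu)
    {q r : LatticePoint} (hq : H q.i q.j ≤ q.n) (hr : H r.i r.j ≤ r.n) {e e' : EdgeIndex}
    {F G : LaurentRing} (hF : algebraMap LaurentRing LaurentField F = H.g q)
    (hG : algebraMap LaurentRing LaurentField G = H.g r) {w : ℤ}
    (hw : w = weight u (edgeExp e + edgeExp e') + weightAt u q + weightAt u r)
    {m : LaurentExponent} (hm : (mon (edgeExp e + edgeExp e') * F * G).coeff m ≠ 0) :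
    Admissible u w m := by
  classical
  obtain ⟨n, h1, h2⟩ := exists_of_coeff_mul_ne_zero hm
  rw [coeff_mon_mul] at h1
  have h3 := weight_eq hu hH hq hF h1
  have h4 := weight_eq hu hH hr hG h2
  have hm' : m = (edgeExp e + edgeExp e') + (n - (edgeExp e + edgeExp e')) + (m - n) := by abel
  have hdeg (t : EdgeIndex) : 0 ≤ edgeDeg t m := by
    have h5 := H.edgeDeg_nonneg hq hF t h1
    have h6 := H.edgeDeg_nonneg hr hG t h2
    have h7 : 0 ≤ edgeDeg t (edgeExp e + edgeExp e') := by
      rw [map_add, edgeDeg_edgeExp, edgeDeg_edgeExp]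
      split_ifs <;> simp
    rw [hm', map_add, map_add]
    omega
  refine ⟨?_, hdeg _, hdeg _, hdeg _, hdeg _⟩
  rw [hm', map_add, map_add, h3, h4, hw]

theorem stronglySplit (h : HeightFunction) (p : LatticePoint) (hp : h p.i p.j < p.n)
    {FN FS FE FW : LaurentRing}
    (hN : algebraMap LaurentRing LaurentField FN = h.g p.north)
    (hS : algebraMap LaurentRing LaurentField FS = h.g p.south)
    (hE : algebraMap LaurentRing LaurentField FE = h.g p.east)
    (hW : algebraMap LaurentRing LaurentField FW = h.g p.west) :
    StronglySplit (mon p.acExp * FN * FS) (mon p.bdExp * FE * FW) := by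
  induction hc : (h.coneAbove p).ncard using Nat.strong_induction_on
    generalizing h p FN FS FE FW with
  | _ c ih =>
    obtain ⟨u, hpu, hu⟩ := h.exists_isLowest hp
    by_cases h0 : p = u
    · subst h0
      obtain ⟨eN, eS, eE, eW, -⟩ := g_top_middle hu
      rw [eN] at hN
      rw [eS] at hS
      rw [eE] at hE
      rw [eW] at hW
      rw [algebraMap_injective hN, algebraMap_injective hS, algebraMap_injective hE,
        algebraMap_injective hW, ← mon_add, ← mon_add, ← mon_add, ← mon_add]
      change StronglySplit (mon (acTerm p)) (mon (bdTerm p))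
      -- In the base case the two monomials already differ in their edge variables.
      have hne : (acTerm p).2 ≠ (bdTerm p).2 := by
        intro h1
        have h2 := (edgeDeg_acTerm p).1
        rw [edgeDeg_apply, h1, ← edgeDeg_apply, (edgeDeg_bdTerm p).1] at h2
        exact zero_ne_one h2
      have hne' : acTerm p ≠ bdTerm p := fun h1 => hne (congrArg _ h1)
      refine ⟨fun m hm => ?_, fun m n hm hn hmn => ?_⟩
      · rcases hm with hm | hm <;> rw [← eq_of_coeff_mon_ne_zero hm] <;>
          refine ⟨?_, 0, ?_⟩
        · exact Or.inl ⟨by rw [coeff_mon_same]; exact one_ne_zero,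
            not_not.2 (coeff_mon_ne hne'.symm)⟩
        · rw [coeff_add, Finsupp.add_apply, coeff_mon_same, coeff_mon_ne hne'.symm]
          rfl
        · exact Or.inr ⟨by rw [coeff_mon_same]; exact one_ne_zero,
            not_not.2 (coeff_mon_ne hne')⟩
        · rw [coeff_add, Finsupp.add_apply, coeff_mon_same, coeff_mon_ne hne']
          rfl
      · rcases hm with hm | hm <;> rcases hn with hn | hn <;>
          obtain rfl := eq_of_coeff_mon_ne_zero hm <;> obtain rfl := eq_of_coeff_mon_ne_zero hn
        · rfl
        · exact absurd hmn hne
        · exact absurd hmn.symm hne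
        · rfl
    · have hL (r : LatticePoint) := exists_laurent (raise hu) r
      have hp' : raise hu p.i p.j < p.n := by
        refine (raise_le hu hp hpu).lt_of_ne fun h1 => ?_
        by_cases hij : p.i = u.i ∧ p.j = u.j
        · rw [hij.1, hij.2, raise_center] at h1
          exact h0 (LatticePoint.ext h1.symm hij.1 hij.2)
        · rw [raise_apply hu hij] at h1
          omega
      obtain ⟨GN, gN⟩ := hL p.north
      obtain ⟨GS, gS⟩ := hL p.south
      obtain ⟨GE, gE⟩ := hL p.east
      obtain ⟨GW, gW⟩ := hL p.west
      have hs := ih _ (hc ▸ ncard_raise_lt hu hpu (InCone.refl p)) (raise hu) p hp' gN gS gE gW rfl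
      have fl {r : LatticePoint} (hr : raise hu r.i r.j ≤ r.n) {F G : LaurentRing}
          (hF : algebraMap LaurentRing LaurentField F = h.g r)
          (hG : algebraMap LaurentRing LaurentField G = (raise hu).g r) :
          flipHom u G = algebraMap LaurentRing LaurentField F := by
        rw [hF]
        exact flipHom_g hu (fun r _ => hL r) (InCone.refl r) hr hG
      obtain ⟨w1, w2⟩ := weightAt_step hu hp
      -- This sum is the common weight of the two terms, hence the bound needed for the flip.
      have hw : weightAt u p + weightAt u p.below ≤ 2 := by
        have h1 := weightAt_le_one u p
        have h2 := weightAt_le_one u p.below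
        omega
      have hac : centerDeg u p.acExp = 0 := by simp [LatticePoint.acExp, faceDeg_edgeExp]
      have hbd : centerDeg u p.bdExp = 0 := by simp [LatticePoint.bdExp, faceDeg_edgeExp]
      have rN := (raise hu).le_north hp'
      have rS := (raise hu).le_south hp'
      have rE := (raise hu).le_east hp'
      have rW := (raise hu).le_west hp'
      refine hs.flip hw
        (fun m hm => admissible_term hu (Or.inr rfl) rN rS gN gS w1 hm)
        (fun m hm => admissible_term hu (Or.inl rfl) (h.le_north hp) (h.le_south hp) hN hS w1 hm)
        (fun m hm => admissible_term hu (Or.inr rfl) rE rW gE gW w2 hm)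
        (fun m hm => admissible_term hu (Or.inl rfl) (h.le_east hp) (h.le_west hp) hE hW w2 hm)
        ?_ ?_
      · change flipHom u (mon p.acExp * GN * GS) = _
        simp only [map_mul, flipHom_mon_of_centerDeg hac, fl rN hN gN, fl rS hS gS]
      · change flipHom u (mon p.bdExp * GE * GW) = _
        simp only [map_mul, flipHom_mon_of_centerDeg hbd, fl rE hE gE, fl rW hW gW]

end Octahedron

/-! ### Descent to `R` and `K`, and setting the face variables to 1. -/

namespace Octahedron

open GroupAlgebra AddMonoidAlgebra

/-- The embedding of the exponents of monomials of `R` into the exponents of all Laurent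
monomials. -/
noncomputable def toLaurentExponent : Exponent →+ LaurentExponent :=
  (AddMonoidHom.id _).prodMap (Finsupp.mapRange.addMonoidHom (Nat.castAddMonoidHom ℤ))

theorem toLaurentExponent_injective : Function.Injective toLaurentExponent := by
  intro m n hmn
  have h1 : (toLaurentExponent m).1 = (toLaurentExponent n).1 := congrArg Prod.fst hmn
  have h2 : (toLaurentExponent m).2 = (toLaurentExponent n).2 := congrArg Prod.snd hmn
  exact Prod.ext h1 (Finsupp.ext fun e => Int.ofNat_inj.1 (DFunLike.congr_fun h2 e))

theorem mem_range_toLaurentExponent {m : LaurentExponent} (hm : ∀ e, 0 ≤ edgeDeg e m) :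
    m ∈ Set.range toLaurentExponent := by
  refine ⟨(m.1, m.2.mapRange Int.toNat rfl), Prod.ext rfl (Finsupp.ext fun e => ?_)⟩
  exact Int.toNat_of_nonneg (hm e)

/-- The embedding of `R` into the ring of all Laurent polynomials. -/
noncomputable def toLaurent : R →+* LaurentRing :=
  AddMonoidAlgebra.mapDomainRingHom ℤ toLaurentExponent

theorem toLaurent_injective : Function.Injective toLaurent :=
  mapDomain_injective toLaurentExponent_injective

theorem coeff_toLaurent (P : R) (m : Exponent) :
    (toLaurent P).coeff (toLaurentExponent m) = P.coeff m :=
  Finsupp.mapDomain_apply toLaurentExponent_injective _ _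

theorem toLaurent_single (m : Exponent) :
    toLaurent (single m 1) = mon (toLaurentExponent m) :=
  mapDomain_single

theorem toLaurent_faceR (v : FaceIndex) : toLaurent (faceR v) = mon (faceExp v) := by
  rw [faceR, toLaurent_single]
  congr 1

theorem toLaurent_edgeR (e : EdgeIndex) : toLaurent (edgeR e) = mon (edgeExp e) := by
  rw [edgeR, toLaurent_single]
  congr 1
  simp [toLaurentExponent, edgeExp]

theorem exists_toLaurent_eq (h : HeightFunction) {q : LatticePoint} (hq : h q.i q.j ≤ q.n) :
    ∃ F : R, algebraMap LaurentRing LaurentField (toLaurent F) = h.g q := by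
  obtain ⟨G, hG⟩ := exists_laurent h q
  refine ⟨comapDomain toLaurentExponent toLaurentExponent_injective G, ?_⟩
  rw [← hG]
  congr 1
  refine mapDomain_comapDomain (fun m hm => ?_) toLaurentExponent_injective
  exact mem_range_toLaurentExponent fun e =>
    h.edgeDeg_nonneg hq hG e (Finsupp.mem_support_iff.1 hm)

theorem g_relation {h : HeightFunction} {q : LatticePoint} (hq : h q.i q.j < q.n)
    {F FB FN FS FE FW : R}
    (hF : algebraMap LaurentRing LaurentField (toLaurent F) = h.g q)
    (hB : algebraMap LaurentRing LaurentField (toLaurent FB) = h.g q.below)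
    (hN : algebraMap LaurentRing LaurentField (toLaurent FN) = h.g q.north)
    (hS : algebraMap LaurentRing LaurentField (toLaurent FS) = h.g q.south)
    (hE : algebraMap LaurentRing LaurentField (toLaurent FE) = h.g q.east)
    (hW : algebraMap LaurentRing LaurentField (toLaurent FW) = h.g q.west) :
    F * FB = edgeR q.edgeA * edgeR q.edgeC * FN * FS +
      edgeR q.edgeB * edgeR q.edgeD * FE * FW := by
  refine toLaurent_injective (algebraMap_injective ?_)
  simp only [map_mul, map_add, toLaurent_edgeR]
  rw [hF, hB, hN, hS, hE, hW, h.g_mul_g_below hq, LatticePoint.acExp, LatticePoint.bdExp,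
    mon_add, mon_add, map_mul, map_mul]

theorem algebraMap_ne_zero {h : HeightFunction} {q : LatticePoint} {F : R}
    (hF : algebraMap LaurentRing LaurentField (toLaurent F) = h.g q) : algebraMap R K F ≠ 0 := by
  rw [map_ne_zero_iff _ (IsFractionRing.injective R K)]
  rintro rfl
  rw [map_zero, map_zero] at hF
  exact h.g_ne_zero q hF.symm

/-- The functions `f` and `g` live in different fields, but `g_relation` holds already in `R`, so
the recurrence can be transported. -/
theorem algebraMap_eq_f {h : HeightFunction} {q : LatticePoint} (hq : h q.i q.j ≤ q.n) {F : R}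
    (hF : algebraMap LaurentRing LaurentField (toLaurent F) = h.g q) :
    algebraMap R K F = h.f q := by
  refine h.octahedron_induction (motive := fun q => ∀ F : R,
    algebraMap LaurentRing LaurentField (toLaurent F) = h.g q → algebraMap R K F = h.f q)
    (fun q h0 F hF => ?_) (fun q h0 iN iS iE iW iB F hF => ?_) q hq F hF
  · rw [h.g_of_not_lt h0.not_lt, ← toLaurent_faceR] at hF
    rw [toLaurent_injective (algebraMap_injective hF), HeightFunction.f, dif_neg h0.not_lt, x]
  · obtain ⟨FN, hN⟩ := exists_toLaurent_eq h (h.le_north h0)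
    obtain ⟨FS, hS⟩ := exists_toLaurent_eq h (h.le_south h0)
    obtain ⟨FE, hE⟩ := exists_toLaurent_eq h (h.le_east h0)
    obtain ⟨FW, hW⟩ := exists_toLaurent_eq h (h.le_west h0)
    obtain ⟨FB, hB⟩ := exists_toLaurent_eq h (h.le_below h0)
    have h1 := congrArg (algebraMap R K) (g_relation h0 hF hB hN hS hE hW)
    simp only [map_mul, map_add] at h1
    rw [HeightFunction.f, dif_pos h0, ← iN FN hN, ← iS FS hS, ← iE FE hE, ← iW FW hW,
      ← iB FB hB, eq_div_iff (algebraMap_ne_zero hB), h1]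
    rfl

/-- No two monomials with exponents in S merge when the face variables are forgotten. -/
theorem coeff_setFacesOne {S : Set Exponent} (hS : Set.InjOn Prod.snd S) {P : R}
    (hP : ∀ m, P.coeff m ≠ 0 → m ∈ S) {m : Exponent} (hm : m ∈ S) :
    (setFacesOne P).coeff m.2 = P.coeff m :=
  Finsupp.mapDomain_apply' S _ (fun n hn => hP n (Finsupp.mem_support_iff.1 hn)) hS hm

theorem exists_of_coeff_setFacesOne_ne_zero {P : R} {e : EdgeIndex →₀ ℕ}
    (he : (setFacesOne P).coeff e ≠ 0) : ∃ m, P.coeff m ≠ 0 ∧ m.2 = e := by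
  classical
  have h1 := Finsupp.mapDomain_support (Finsupp.mem_support_iff.2 he)
  obtain ⟨m, hm, hme⟩ := Finset.mem_image.1 h1
  exact ⟨m, Finsupp.mem_support_iff.1 hm, hme⟩

theorem StronglySplit.monomialsSplit {P Q : R} (hs : StronglySplit (toLaurent P) (toLaurent Q)) :
    MonomialsSplit P Q ∧ MonomialsSplit (setFacesOne P) (setFacesOne Q) := by
  have hsplit : MonomialsSplit P Q := by
    intro m hm
    have := hs.split (toLaurentExponent m)
    rw [← map_add, coeff_toLaurent, coeff_toLaurent, coeff_toLaurent] at this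
    exact this hm
  refine ⟨hsplit, fun e he => ?_⟩
  let S : Set Exponent := {m | P.coeff m ≠ 0 ∨ Q.coeff m ≠ 0}
  have hS : Set.InjOn Prod.snd S := by
    intro m hm n hn hmn
    refine toLaurentExponent_injective (hs.inj _ _ ?_ ?_ ?_)
    · rwa [coeff_toLaurent, coeff_toLaurent]
    · rwa [coeff_toLaurent, coeff_toLaurent]
    · exact congrArg (Finsupp.mapRange.addMonoidHom (Nat.castAddMonoidHom ℤ)) hmn
  obtain ⟨m, hm, rfl⟩ : ∃ m ∈ S, m.2 = e := by
    rcases he with he | he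
    · obtain ⟨m, hm, hme⟩ := exists_of_coeff_setFacesOne_ne_zero he
      exact ⟨m, Or.inl hm, hme⟩
    · obtain ⟨m, hm, hme⟩ := exists_of_coeff_setFacesOne_ne_zero he
      exact ⟨m, Or.inr hm, hme⟩
  have h1 := hsplit m hm
  rw [coeff_add, Finsupp.add_apply] at h1 ⊢
  rwa [coeff_setFacesOne hS (fun _ => Or.inl) hm, coeff_setFacesOne hS (fun _ => Or.inr) hm]

end Octahedron

theorem mainTheorem6 (h : HeightFunction) (p : LatticePoint) (hp : h p.i p.j < p.n) :
    h.f p * h.f p.below =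
        y p.edgeA * y p.edgeC * h.f p.north * h.f p.south +
          y p.edgeB * y p.edgeD * h.f p.east * h.f p.west ∧
      ∃ P Q : R,
        algebraMap R K P = y p.edgeA * y p.edgeC * h.f p.north * h.f p.south ∧
        algebraMap R K Q = y p.edgeB * y p.edgeD * h.f p.east * h.f p.west ∧
        MonomialsSplit P Q ∧
        MonomialsSplit (setFacesOne P) (setFacesOne Q) := by
  obtain ⟨F, hF⟩ := exists_toLaurent_eq h hp.le
  obtain ⟨FN, hN⟩ := exists_toLaurent_eq h (h.le_north hp)
  obtain ⟨FS, hS⟩ := exists_toLaurent_eq h (h.le_south hp)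
  obtain ⟨FE, hE⟩ := exists_toLaurent_eq h (h.le_east hp)
  obtain ⟨FW, hW⟩ := exists_toLaurent_eq h (h.le_west hp)
  obtain ⟨FB, hB⟩ := exists_toLaurent_eq h (h.le_below hp)
  have hP : algebraMap R K (edgeR p.edgeA * edgeR p.edgeC * FN * FS) =
      y p.edgeA * y p.edgeC * h.f p.north * h.f p.south := by
    rw [map_mul, map_mul, map_mul, algebraMap_eq_f (h.le_north hp) hN,
      algebraMap_eq_f (h.le_south hp) hS, y, y]
  have hQ : algebraMap R K (edgeR p.edgeB * edgeR p.edgeD * FE * FW) =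
      y p.edgeB * y p.edgeD * h.f p.east * h.f p.west := by
    rw [map_mul, map_mul, map_mul, algebraMap_eq_f (h.le_east hp) hE,
      algebraMap_eq_f (h.le_west hp) hW, y, y]
  refine ⟨?_, _, _, hP, hQ, StronglySplit.monomialsSplit ?_⟩
  · rw [← hP, ← hQ, ← map_add, ← g_relation hp hF hB hN hS hE hW, map_mul,
      algebraMap_eq_f hp.le hF, algebraMap_eq_f (h.le_below hp) hB]
  · have := stronglySplit h p hp hN hS hE hW
    rw [LatticePoint.acExp, LatticePoint.bdExp, GroupAlgebra.mon_add, GroupAlgebra.mon_add] at this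
    simpa only [map_mul, toLaurent_edgeR] using this
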